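/- **Setting.** For $\rho,T>0$, $u,v\in\mathbb R^3$ let $M(\rho,T,u;v)=\frac{\rho}{(2\pi T)^{3/2}}e^{-|v-u|^2/(2T)}$, and let $$Q(f,g)(v)=\tfrac12\int_{\mathbb R^3}dv_*\int_{|n|=1}dn\,\tfrac12|n\cdot(v-v_*)|\,\{f'_*g'+f'g'_*-f_*g-g_*f\}$$ be the hard-sphere Boltzmann collision integral, with $v'=v-n\,(v-v_*)\cdot n$, $v'_*=v_*+n\,(v-v_*)\cdot n$. For $T>0$ put $M_T=M(1,T,0;\cdot)$, $\mathcal L_Tf=2Q(M_T,f)$, $(f,g)_T=\int M_T^{-1}fg\,dv$, and let $\mathcal H_T$ be the corresponding Hilbert space; the domain of $\mathcal L_T$ is $\{f\in\mathcal H_T:(1+|v|)f\in\mathcal H_T\}$. Let $\mathfrak A_T$ and $\mathfrak B_T$ be the solutions in the domain, orthogonal in $\mathcal H_T$ to $M_T,\,v_xM_T,\,v_yM_T,\,v_zM_T,\,\frac{|v|^2}{2}M_T$, of $$\mathcal L_T\mathfrak A_T=\tilde{\mathfrak A}_T:=\frac{|v|^2-5T}{2T^2}\,v_yM_T,\qquad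 \mathcal L_T\mathfrak B_T=\tilde{\mathfrak B}_T:=\frac{v_xv_y}{T}\,M_T .$$ The viscosity and the heat conductivity are $$\eta(T)=-T\,(\mathfrak B_T,\tilde{\mathfrak B}_T)_T=-\int v_xv_y\mathfrak B_T\,dv,\qquad \kappa(T)=-T^2(\mathfrak A_T,\tilde{\mathfrak A}_T)_T=-\int \tfrac{|v|^2-5T}{2}v_y\mathfrak A_T\,dv .$$ Let $\sigma_1,\sigma_2$ be arbitrary $C^\infty$ functions of the temperature $T>0$, and let $C\neq0$, $U_-,U_+\in\mathbb R$. For $\delta>0$ write $\rho=1+\delta r$, $T=1+\delta\tau$, $\mathcal P=\rho T$; evaluate $\eta,\kappa,\sigma_1,\sigma_2$ at $T=1+\delta\tau(y)$, and put $\eta_0=\eta(1)$, $\eta_\delta=\eta-\eta_0$. The stationary one-dimensional hydrodynamic system (HD) for $(U,u_y,\tau,r,\mathcal P_2)$ on $(-\pi,\pi)$ is $$\begin{aligned} &\partial_y(\rho u_y)=0,\qquad \partial_y[(1+\delta r)(1+\delta\tau)]=0,\\ &\rho u_y\partial_yU=\partial_y(\eta\,\partial_yU),\\ &\tfrac52\rho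 u_y\partial_y\tau=\partial_y(\kappa\,\partial_y\tau)+\delta\,\eta\,(\partial_yU)^2,\\ &\rho u_y\partial_yu_y+\partial_y\mathcal P_2-\tfrac1{C^2}\rho U^2=\eta_0\partial_y^2u_y+\partial_y\Big(\eta_\delta\partial_yu_y+\tfrac{\delta^2}{\mathcal P}\big[\sigma_1(\partial_y\tau)^2+\sigma_2(\partial_yU)^2\big]\Big), \end{aligned}$$ with boundary conditions $u_y(\pm\pi)=0$, $U(\pm\pi)=U_\pm$, $\tau(\pm\pi)=r(\pm\pi)=0$. A smooth solution means: all five functions are $C^\infty$ on $(-\pi,\pi)$, and $U,u_y,\tau,r$ are continuous on $[-\pi,\pi]$. The laminar Couette solution is $\bar U(y)=U_-+\beta(y+\pi)$, $\beta=\frac{U_+-U_-}{2\pi}$, $\tau=0$. **Theorem.** There are $\delta_0>0$ and $K>0$, depending only on $\sigma_1,\sigma_2,C,U_\pm$ (and on the coefficients $\eta,\kappa$), such that for every $0<\delta<\delta_0$ the system (HD) with these boundary conditions has a smooth solution; it is unique, $\mathcal P_2$ being determined up to an additive constant. This solution satisfies $u_y=0$ and is within $O(\delta)$ of the laminar solution: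 $$|U-\bar U|\le K\delta,\quad|\tau|\le K\delta,\quad|r|\le K\delta\ \text{ on }[-\pi,\pi],\qquad |\partial_yU-\beta|\le K\delta,\quad|\partial_y\tau|\le K\delta\ \text{ on }(-\pi,\pi).$$ -/

import Mathlib

open MeasureTheory Set
open scoped ContDiff

noncomputable section

/-! Hard-sphere collision operator and the transport coefficients. -/

/-- Velocities `v = (v_x, v_y, v_z)`, with coordinates `v 0`, `v 1`, `v 2`. -/
abbrev Velocity : Type := EuclideanSpace ℝ (Fin 3)

/-- The Maxwellian with density `ρ`, temperature `T` and mean velocity `u`. -/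
def maxwellian (ρ T : ℝ) (u v : Velocity) : ℝ :=
  ρ / (2 * Real.pi * T) ^ ((3 : ℝ) / 2) * Real.exp (-(‖v - u‖ ^ 2) / (2 * T))

/-- The velocity of the first particle before the collision: `v - n ((v - w) · n)`. -/
def preFst (v w n : Velocity) : Velocity := v - (inner ℝ (v - w) n : ℝ) • n

/-- The velocity of the second particle before the collision: `w + n ((v - w) · n)`. -/
def preSnd (v w n : Velocity) : Velocity := w + (inner ℝ (v - w) n : ℝ) • n

/-- The symmetrized Boltzmann collision integral for hard spheres, with cross section
`B(n, V) = |V · n| / 2` and the surface measure of the unit sphere. -/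
def collisionQ (f g : Velocity → ℝ) (v : Velocity) : ℝ :=
  1 / 2 * ∫ w : Velocity, ∫ n : Metric.sphere (0 : Velocity) 1,
    |(inner ℝ (v - w) (n : Velocity) : ℝ)| / 2 *
      (f (preSnd v w n) * g (preFst v w n) + f (preFst v w n) * g (preSnd v w n)
        - f w * g v - g w * f v) ∂((volume : Measure Velocity).toSphere)

/-- The centred Maxwellian with density `1` and temperature `T`. -/
def maxwellianT (T : ℝ) : Velocity → ℝ := maxwellian 1 T 0

/-- The linearized collision operator `f ↦ 2 Q(M, f)` at the centred Maxwellian. -/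
def linearizedQ (T : ℝ) (f : Velocity → ℝ) (v : Velocity) : ℝ :=
  2 * collisionQ (maxwellianT T) f v

/-- The inner product `(f, g) = ∫ M⁻¹ f g dv` of the Hilbert space `ℋ`. -/
def innerH (T : ℝ) (f g : Velocity → ℝ) : ℝ :=
  ∫ v : Velocity, (maxwellianT T v)⁻¹ * f v * g v

/-- Membership in `ℋ`. -/
def MemH (T : ℝ) (f : Velocity → ℝ) : Prop :=
  AEStronglyMeasurable f (volume : Measure Velocity) ∧
    Integrable (fun v : Velocity => (maxwellianT T v)⁻¹ * f v ^ 2)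

/-- The domain of the linearized operator: `f` and `ν f` belong to `ℋ`, where the collision
frequency `ν` of hard spheres is comparable to `1 + |v|`. -/
def MemDomainL (T : ℝ) (f : Velocity → ℝ) : Prop :=
  MemH T f ∧ MemH T (fun v => (1 + ‖v‖) * f v)

/-- The collision invariants `1, v_x, v_y, v_z, |v|² / 2`. -/
def collisionInvariant (i : Fin 5) (v : Velocity) : ℝ :=
  ![1, v 0, v 1, v 2, ‖v‖ ^ 2 / 2] i

/-- `f` is the solution of `L f = g` in the orthogonal complement of the null space of `L`
(which is spanned by the collision invariants times `M`); that is, `f = L⁻¹ g`. -/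
structure IsInverseL (T : ℝ) (g f : Velocity → ℝ) : Prop where
  mem_domain : MemDomainL T f
  orthogonal : ∀ i : Fin 5,
    innerH T (fun v => collisionInvariant i v * maxwellianT T v) f = 0
  equation : linearizedQ T f =ᵐ[volume] g

/-- The source `(v_x v_y / T) M` multiplying the gradient of `U` in `v_y ∂_y M`. -/
def shearSource (T : ℝ) (v : Velocity) : ℝ := v 0 * v 1 / T * maxwellianT T v

/-- The source `((|v|² - 5 T) / (2 T²)) v_y M` multiplying the gradient of `τ` in `v_y ∂_y M`. -/
def heatSource (T : ℝ) (v : Velocity) : ℝ :=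
  (‖v‖ ^ 2 - 5 * T) / (2 * T ^ 2) * v 1 * maxwellianT T v

/-- The viscosity `η(T) = - T (𝔅, L 𝔅) = - ∫ v_x v_y 𝔅 dv`, where `𝔅 T` is `L⁻¹` of the shear
source at temperature `T`. -/
def viscosity (𝔅 : ℝ → Velocity → ℝ) (T : ℝ) : ℝ :=
  -(T * innerH T (𝔅 T) (shearSource T))

/-- The heat conductivity `κ(T) = - T² (𝔄, L 𝔄) = - ∫ ((|v|² - 5 T) / 2) v_y 𝔄 dv`, where `𝔄 T`
is `L⁻¹` of the heat source at temperature `T`. -/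
def conductivity (𝔄 : ℝ → Velocity → ℝ) (T : ℝ) : ℝ :=
  -(T ^ 2 * innerH T (𝔄 T) (heatSource T))

/-! The stationary one-dimensional hydrodynamic system. -/

/-- `(U, u, τ, r, P)` is a smooth solution on `(-π, π)` of the stationary system, where `u` is the
radial velocity `u_y`, `P` is the second-order pressure, the density is `1 + δ r`, the temperature
is `1 + δ τ`, and the transport coefficients are evaluated at the temperature. The fields with
boundary conditions are continuous up to the boundary. -/
structure IsHDSolution (η κ σ₁ σ₂ : ℝ → ℝ) (C Uminus Uplus δ : ℝ) (U u τ r P : ℝ → ℝ) :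
    Prop where
  smooth_U : ContDiffOn ℝ ∞ U (Ioo (-Real.pi) Real.pi)
  smooth_u : ContDiffOn ℝ ∞ u (Ioo (-Real.pi) Real.pi)
  smooth_τ : ContDiffOn ℝ ∞ τ (Ioo (-Real.pi) Real.pi)
  smooth_r : ContDiffOn ℝ ∞ r (Ioo (-Real.pi) Real.pi)
  smooth_P : ContDiffOn ℝ ∞ P (Ioo (-Real.pi) Real.pi)
  cont_U : ContinuousOn U (Icc (-Real.pi) Real.pi)
  cont_u : ContinuousOn u (Icc (-Real.pi) Real.pi)
  cont_τ : ContinuousOn τ (Icc (-Real.pi) Real.pi)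
  cont_r : ContinuousOn r (Icc (-Real.pi) Real.pi)
  /-- conservation of mass -/
  mass : ∀ y ∈ Ioo (-Real.pi) Real.pi, deriv (fun s => (1 + δ * r s) * u s) y = 0
  /-- constancy of the pressure `ρ T` -/
  pressure : ∀ y ∈ Ioo (-Real.pi) Real.pi,
    deriv (fun s => (1 + δ * r s) * (1 + δ * τ s)) y = 0
  /-- tangential momentum -/
  tangential : ∀ y ∈ Ioo (-Real.pi) Real.pi,
    (1 + δ * r y) * u y * deriv U y = deriv (fun s => η (1 + δ * τ s) * deriv U s) y
  /-- energy -/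
  energy : ∀ y ∈ Ioo (-Real.pi) Real.pi,
    5 / 2 * (1 + δ * r y) * u y * deriv τ y =
      deriv (fun s => κ (1 + δ * τ s) * deriv τ s) y
        + δ * (η (1 + δ * τ y) * deriv U y ^ 2)
  /-- radial momentum, with the curvature term `ρ U² / C²` -/
  radial : ∀ y ∈ Ioo (-Real.pi) Real.pi,
    (1 + δ * r y) * u y * deriv u y + deriv P y - 1 / C ^ 2 * (1 + δ * r y) * U y ^ 2 =
      η 1 * deriv (deriv u) y
        + deriv (fun s => (η (1 + δ * τ s) - η 1) * deriv u s
            + δ ^ 2 / ((1 + δ * r s) * (1 + δ * τ s)) *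
              (σ₁ (1 + δ * τ s) * deriv τ s ^ 2 + σ₂ (1 + δ * τ s) * deriv U s ^ 2)) y
  u_left : u (-Real.pi) = 0
  u_right : u Real.pi = 0
  U_left : U (-Real.pi) = Uminus
  U_right : U Real.pi = Uplus
  τ_left : τ (-Real.pi) = 0
  τ_right : τ Real.pi = 0
  r_left : r (-Real.pi) = 0
  r_right : r Real.pi = 0

/-- The slope `β = (U₊ - U₋) / (2 π)` of the laminar Couette flow. -/
def couetteSlope (Uminus Uplus : ℝ) : ℝ := (Uplus - Uminus) / (2 * Real.pi)

/-- The laminar Couette flow `U₋ + β (y + π)`. -/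
def couette (Uminus Uplus y : ℝ) : ℝ := Uminus + couetteSlope Uminus Uplus * (y + Real.pi)

end

/-!
For hard spheres the linearized operator scales like a speed under dilations of velocity space.
Together with its symmetry (which replaces uniqueness of `L⁻¹`), this gives
`η(T) = η(1) √T` and `κ(T) = κ(1) √T` (`viscosity_eq_sqrt`, `conductivity_eq_sqrt`). The weak form
of the operator (`innerH_linearizedQ`) shows that it is symmetric and dissipative, whence
`η(1), κ(1) > 0`.

With these laws the system can be integrated explicitly for every `δ > 0`. The mass equation and
the constancy of `ρ T` give `u = 0` and `ρ T = 1`, and by connectedness `T > 0`. The shear stress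
`√T U'` is constant, and since viscosity and conductivity are proportional, so is the flux
`√T (κ₀ τ + δ η₀ U² / 2)'`. A function with constant flux and equal end values is constant, so `τ`
is the quadratic polynomial `δ η₀ (U - U₋) (U₊ - U) / (2 κ₀)` of `U`. Writing
`U = U₋ + (U₊ - U₋) x`, the temperature becomes `1 + ε x (1 - x)` with
`ε = δ² η₀ (U₊ - U₋)² / (2 κ₀)`, and the constancy of `√T x'` says that
`∫₀ˣ √(1 + ε s (1 - s)) ds` is affine in `y`. This integral is a strictly increasing function of `x`
on `[0, 1]`, which determines `x` (`IsProfile`) and gives existence, uniqueness, smoothness, and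
the distance `O(ε)` to the affine profile. The pressure follows by integrating the radial momentum
equation.
-/

/-! ### Collision differences on an abstract collision space -/

/-- The collision difference `X(p') + X(p'_*) - X(p) - X(p_*)` of a function `X`, where `S` is the
collision map and `R` exchanges the two particles. -/
def collDiff {Ω : Type*} (R S : Ω → Ω) (X : Ω → ℝ) (p : Ω) : ℝ :=
  X (S p) + X (R (S p)) - X p - X (R p)

theorem memLp_collDiff {Ω : Type*} [MeasurableSpace Ω] {ν : Measure Ω} {R S : Ω → Ω}
    (hR : MeasurePreserving R ν ν) (hS : MeasurePreserving S ν ν) {X : Ω → ℝ}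
    (hX : MemLp X 2 ν) : MemLp (collDiff R S X) 2 ν :=
  (((hX.comp_measurePreserving hS).add
    ((hX.comp_measurePreserving hR).comp_measurePreserving hS)).sub hX).sub
      (hX.comp_measurePreserving hR)

/-- The weak form of the collision operator: exchanging the particles and exchanging pre- and
post-collisional velocities symmetrizes `∫ Y ΔX`. -/
theorem integral_mul_collDiff {Ω : Type*} [MeasurableSpace Ω] {ν : Measure Ω} {R S : Ω → Ω}
    (hR : MeasurePreserving R ν ν) (hS : MeasurePreserving S ν ν)
    (hRR : ∀ p, R (R p) = p) (hSS : ∀ p, S (S p) = p) (hRS : ∀ p, R (S p) = S (R p))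
    {X Y : Ω → ℝ} (hX : MemLp X 2 ν) (hY : MemLp Y 2 ν) :
    ∫ p, Y p * collDiff R S X p ∂ν
      = -(1 / 4) * ∫ p, collDiff R S Y p * collDiff R S X p ∂ν := by
  have hZ := memLp_collDiff hR hS hX
  have key : ∀ {A : Ω → Ω} {W : Ω → ℝ}, MeasurePreserving A ν ν → MemLp W 2 ν →
      ∫ p, W (A p) * collDiff R S X (A p) ∂ν = ∫ p, W p * collDiff R S X p ∂ν := by
    intro A W hA hW
    have hm : AEStronglyMeasurable (fun p => W p * collDiff R S X p) (Measure.map A ν) := by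
      rw [hA.map_eq]
      exact (hW.integrable_mul hZ).aestronglyMeasurable
    rw [← integral_map hA.aemeasurable hm, hA.map_eq]
  have zR : ∀ p, collDiff R S X (R p) = collDiff R S X p := by
    intro p
    simp only [collDiff, ← hRS, hRR]
    ring
  have zS : ∀ p, collDiff R S X (S p) = -collDiff R S X p := by
    intro p
    simp only [collDiff, hSS, hRS]
    ring
  have hYR := hY.comp_measurePreserving hR
  have e1 := key hR hY
  have e2 := key hS hY
  have e3 := key hS hYR
  simp only [zR, zS, Function.comp_apply, mul_neg, integral_neg] at e1 e2 e3
  have i0 := hY.integrable_mul hZ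
  have i1 := hYR.integrable_mul hZ
  have i2 := (hY.comp_measurePreserving hS).integrable_mul hZ
  have i3 := (hYR.comp_measurePreserving hS).integrable_mul hZ
  have e4 : ∫ p, collDiff R S Y p * collDiff R S X p ∂ν
      = ∫ p, Y (S p) * collDiff R S X p ∂ν + ∫ p, Y (R (S p)) * collDiff R S X p ∂ν
        - ∫ p, Y p * collDiff R S X p ∂ν - ∫ p, Y (R p) * collDiff R S X p ∂ν := by
    rw [← integral_add, ← integral_sub, ← integral_sub]
    · refine integral_congr_ae (Filter.Eventually.of_forall fun p => ?_)
      simp only [collDiff]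
      ring
    · exact (i2.add i3).sub i0
    · exact i1
    · exact i2.add i3
    · exact i0
    · exact i2
    · exact i3
  rw [e4]
  linarith

/-! ### The collision space of hard spheres -/

/-- The unit sphere of collision directions. -/
abbrev Directions : Type := Metric.sphere (0 : Velocity) 1

/-- The space of collisions `(n, (v, w))`. -/
abbrev Collisions : Type := Directions × (Velocity × Velocity)

/-- The reference measure `dn dv dw` on the space of collisions. -/
noncomputable def collMeasure : Measure Collisions :=
  ((volume : Measure Velocity).toSphere).prod
    ((volume : Measure Velocity).prod (volume : Measure Velocity))

/-- The exchange of the two particles. -/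
def collSwap (p : Collisions) : Collisions := (p.1, p.2.swap)

/-- The passage to the pre-collisional velocities, at a fixed direction. -/
noncomputable def collMap (p : Collisions) : Collisions :=
  (p.1, (preFst p.2.1 p.2.2 p.1, preSnd p.2.1 p.2.2 p.1))

theorem inner_direction_self (n : Directions) : inner ℝ (n : Velocity) (n : Velocity) = (1 : ℝ) := by
  rw [real_inner_self_eq_norm_sq, norm_eq_of_mem_sphere]
  norm_num

theorem inner_preFst_sub_preSnd (v w : Velocity) (n : Directions) :
    inner ℝ (preFst v w n - preSnd v w n) (n : Velocity) = -(inner ℝ (v - w) (n : Velocity) : ℝ) := by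
  simp only [preFst, preSnd, inner_sub_left, inner_add_left, real_inner_smul_left,
    inner_direction_self]
  ring

theorem collSwap_collSwap (p : Collisions) : collSwap (collSwap p) = p := rfl

theorem preFst_preFst_preSnd (v w : Velocity) (n : Directions) :
    preFst (preFst v w n) (preSnd v w n) n = v := by
  rw [preFst, inner_preFst_sub_preSnd, preFst]
  module

theorem preSnd_preFst_preSnd (v w : Velocity) (n : Directions) :
    preSnd (preFst v w n) (preSnd v w n) n = w := by
  rw [preSnd, inner_preFst_sub_preSnd, preSnd]
  module

theorem collMap_collMap (p : Collisions) : collMap (collMap p) = p := by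
  simp only [collMap, preFst_preFst_preSnd, preSnd_preFst_preSnd]

theorem preFst_swap (v w n : Velocity) : preFst w v n = preSnd v w n := by
  simp only [preFst, preSnd, inner_sub_left]
  module

theorem collSwap_collMap (p : Collisions) : collSwap (collMap p) = collMap (collSwap p) := by
  obtain ⟨n, v, w⟩ := p
  change ((n, (preSnd v w n, preFst v w n)) : Collisions) = (n, (preFst w v n, preSnd w v n))
  rw [preFst_swap v w, preFst_swap w v]

theorem norm_sq_preFst_add_norm_sq_preSnd (v w : Velocity) (n : Directions) :
    ‖preFst v w n‖ ^ 2 + ‖preSnd v w n‖ ^ 2 = ‖v‖ ^ 2 + ‖w‖ ^ 2 := by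
  simp only [preFst, preSnd, ← real_inner_self_eq_norm_sq, inner_sub_left, inner_add_left,
    inner_sub_right, inner_add_right, real_inner_smul_left, real_inner_smul_right,
    inner_direction_self, real_inner_comm v (n : Velocity), real_inner_comm w (n : Velocity)]
  ring

theorem measurePreserving_collSwap : MeasurePreserving collSwap collMeasure collMeasure :=
  (MeasurePreserving.id ((volume : Measure Velocity).toSphere)).prod
    (Measure.measurePreserving_swap (μ := (volume : Measure Velocity))
      (ν := (volume : Measure Velocity)))

/-- The collision at a fixed direction as a linear map of the pair of velocities. -/
noncomputable def collLinear (n : Velocity) : Velocity × Velocity →ₗ[ℝ] Velocity × Velocity where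
  toFun p := (preFst p.1 p.2 n, preSnd p.1 p.2 n)
  map_add' p q := by
    ext1 <;> simp only [preFst, preSnd, Prod.fst_add, Prod.snd_add, inner_sub_left,
      inner_add_left] <;> module
  map_smul' c p := by
    ext1 <;> simp only [preFst, preSnd, Prod.smul_fst, Prod.smul_snd, inner_sub_left,
      real_inner_smul_left, RingHom.id_apply] <;> module

theorem map_collLinear (n : Directions) :
    Measure.map (collLinear n) ((volume : Measure Velocity).prod (volume : Measure Velocity))
      = (volume : Measure Velocity).prod (volume : Measure Velocity) := by
  -- the collision is a linear involution, so its determinant is `±1`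
  have hinv : collLinear n ∘ₗ collLinear n = LinearMap.id := by
    ext1 <;> ext1 p <;>
      simp [collLinear, preFst_preFst_preSnd, preSnd_preFst_preSnd]
  have hdet : LinearMap.det (collLinear n) * LinearMap.det (collLinear n) = 1 := by
    rw [← LinearMap.det_comp, hinv, LinearMap.det_id]
  have habs : |LinearMap.det (collLinear (n : Velocity))| = 1 := by
    rcases mul_self_eq_one_iff.mp hdet with h | h <;> simp [h]
  have hne : LinearMap.det (collLinear (n : Velocity)) ≠ 0 := by
    intro h
    simp [h] at habs
  rw [Measure.map_linearMap_addHaar_eq_smul_addHaar _ hne, abs_inv, habs]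
  simp

theorem continuous_collMap : Continuous collMap := by
  unfold collMap preFst preSnd
  fun_prop

theorem measurePreserving_collMap : MeasurePreserving collMap collMeasure collMeasure := by
  refine MeasurePreserving.skew_product
    (g := fun (n : Directions) (p : Velocity × Velocity) => collLinear (n : Velocity) p)
    (MeasurePreserving.id _) ?_ (Filter.Eventually.of_forall map_collLinear)
  exact (continuous_snd.comp continuous_collMap).measurable

/-! ### The linearized operator in weak form -/

theorem maxwellianT_eq (T : ℝ) (v : Velocity) :
    maxwellianT T v = 1 / (2 * Real.pi * T) ^ ((3 : ℝ) / 2) * Real.exp (-(‖v‖ ^ 2) / (2 * T)) := by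
  simp [maxwellianT, maxwellian]

theorem maxwellianT_pos {T : ℝ} (hT : 0 < T) (v : Velocity) : 0 < maxwellianT T v := by
  rw [maxwellianT_eq]
  positivity

theorem continuous_maxwellianT (T : ℝ) : Continuous (maxwellianT T) := by
  simp only [funext (maxwellianT_eq T)]
  fun_prop

theorem maxwellianT_preFst_mul_preSnd (T : ℝ) (v w : Velocity) (n : Directions) :
    maxwellianT T (preFst v w n) * maxwellianT T (preSnd v w n)
      = maxwellianT T v * maxwellianT T w := by
  simp only [maxwellianT_eq]
  have h := norm_sq_preFst_add_norm_sq_preSnd v w n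
  have e : ∀ a b c : ℝ, c * Real.exp (-a / (2 * T)) * (c * Real.exp (-b / (2 * T)))
      = c * c * Real.exp (-(a + b) / (2 * T)) := by
    intro a b c
    rw [show -(a + b) / (2 * T) = -a / (2 * T) + -b / (2 * T) by ring, Real.exp_add]
    ring
  rw [e, e, h]

/-- The weight `B(n, v - w) M(v) M(w)` of the collision `(n, (v, w))`. -/
noncomputable def collWeight (T : ℝ) (p : Collisions) : NNReal :=
  Real.toNNReal (|(inner ℝ (p.2.1 - p.2.2) (p.1 : Velocity) : ℝ)| / 2
    * (maxwellianT T p.2.1 * maxwellianT T p.2.2))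

theorem coe_collWeight {T : ℝ} (hT : 0 < T) (p : Collisions) :
    (collWeight T p : ℝ) = |(inner ℝ (p.2.1 - p.2.2) (p.1 : Velocity) : ℝ)| / 2
    * (maxwellianT T p.2.1 * maxwellianT T p.2.2) := by
  have h1 := maxwellianT_pos hT p.2.1
  have h2 := maxwellianT_pos hT p.2.2
  exact Real.coe_toNNReal _ (by positivity)

theorem measurable_collWeight (T : ℝ) : Measurable (collWeight T) := by
  have := continuous_maxwellianT T
  have h : Continuous (collWeight T) := by
    unfold collWeight
    fun_prop
  exact h.measurable

theorem collWeight_collSwap (T : ℝ) (p : Collisions) :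
    collWeight T (collSwap p) = collWeight T p := by
  simp only [collWeight, collSwap, Prod.fst_swap, Prod.snd_swap]
  rw [← neg_sub, inner_neg_left, abs_neg, mul_comm (maxwellianT T p.2.2)]

theorem collWeight_collMap (T : ℝ) (p : Collisions) :
    collWeight T (collMap p) = collWeight T p := by
  simp only [collWeight, collMap]
  rw [inner_preFst_sub_preSnd, abs_neg, maxwellianT_preFst_mul_preSnd]

/-- The equilibrium collision measure `B M(v) M(w) dn dv dw`. -/
noncomputable def eqCollMeasure (T : ℝ) : Measure Collisions :=
  collMeasure.withDensity fun p => (collWeight T p : ENNReal)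

theorem measurePreserving_eqCollMeasure {T : ℝ} {A : Collisions → Collisions}
    (hA : MeasurePreserving A collMeasure collMeasure)
    (hw : ∀ p, collWeight T (A p) = collWeight T p) :
    MeasurePreserving A (eqCollMeasure T) (eqCollMeasure T) := by
  refine ⟨hA.measurable, Measure.ext fun s hs => ?_⟩
  rw [Measure.map_apply hA.measurable hs, eqCollMeasure, withDensity_apply _ hs,
    withDensity_apply _ (hA.measurable hs),
    ← hA.setLIntegral_comp_preimage hs (measurable_collWeight T).coe_nnreal_ennreal]
  simp only [hw]

theorem integrable_norm_pow_mul_exp {b : ℝ} (hb : 0 < b) (k : ℕ) :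
    Integrable (fun v : Velocity => ‖v‖ ^ k * Real.exp (-b * ‖v‖ ^ 2)) := by
  rw [integrable_fun_norm_addHaar (volume : Measure Velocity)
    (f := fun r : ℝ => r ^ k * Real.exp (-b * r ^ 2))]
  have h := (integrable_rpow_mul_exp_neg_mul_sq hb (s := ((k + 2 : ℕ) : ℝ))
    (by have : (0 : ℝ) ≤ ((k + 2 : ℕ) : ℝ) := by positivity
        linarith)).integrableOn (s := Ioi 0)
  refine h.congr_fun (fun r _ => ?_) measurableSet_Ioi
  simp only [Real.rpow_natCast, finrank_euclideanSpace, Fintype.card_fin, smul_eq_mul]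
  ring

theorem integrable_norm_pow_mul_maxwellianT {T : ℝ} (hT : 0 < T) (k : ℕ) :
    Integrable (fun v : Velocity => ‖v‖ ^ k * maxwellianT T v) := by
  have h := (integrable_norm_pow_mul_exp (b := (2 * T)⁻¹) (by positivity) k).const_mul
    (1 / (2 * Real.pi * T) ^ ((3 : ℝ) / 2))
  refine h.congr (Filter.Eventually.of_forall fun v => ?_)
  simp only [maxwellianT_eq]
  rw [show -(2 * T)⁻¹ * ‖v‖ ^ 2 = -(‖v‖ ^ 2) / (2 * T) by ring]
  ring

/-- The quotient `f / M` as a function of the collision, through its first particle. -/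
noncomputable def collLift (T : ℝ) (f : Velocity → ℝ) (p : Collisions) : ℝ :=
  f p.2.1 / maxwellianT T p.2.1

/-- Functions in the domain of the linearized operator lift to square integrable functions for the
equilibrium collision measure, because the collision frequency grows linearly. -/
theorem memLp_collLift {T : ℝ} (hT : 0 < T) {f : Velocity → ℝ} (hf : MemDomainL T f) :
    MemLp (collLift T f) 2 (eqCollMeasure T) := by
  have hM := continuous_maxwellianT T
  have hM0 : ∀ v, maxwellianT T v ≠ 0 := fun v => (maxwellianT_pos hT v).ne'
  have hφ : AEStronglyMeasurable (fun v => f v / maxwellianT T v) (volume : Measure Velocity) :=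
    hf.1.1.div₀ hM.aestronglyMeasurable
  have hX : AEStronglyMeasurable (collLift T f) collMeasure :=
    hφ.comp_quasiMeasurePreserving
      (Measure.quasiMeasurePreserving_fst.comp Measure.quasiMeasurePreserving_snd)
  have hXν : AEStronglyMeasurable (collLift T f) (eqCollMeasure T) :=
    hX.mono_ac (withDensity_absolutelyContinuous _ _)
  rw [memLp_two_iff_integrable_sq hXν, eqCollMeasure,
    integrable_withDensity_iff_integrable_smul (measurable_collWeight T)]
  have hA : Integrable (fun v : Velocity => (maxwellianT T v)⁻¹ * ((1 + ‖v‖) * f v) ^ 2) := hf.2.2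
  have hB : Integrable (fun w : Velocity => (1 + ‖w‖) * maxwellianT T w) := by
    have h0 := integrable_norm_pow_mul_maxwellianT hT 0
    have h1 := integrable_norm_pow_mul_maxwellianT hT 1
    refine (h0.add h1).congr (Filter.Eventually.of_forall fun v => ?_)
    simp only [Pi.add_apply]
    ring
  have hone : Integrable (fun _ : Directions => (1 : ℝ)) ((volume : Measure Velocity).toSphere) :=
    integrable_const _
  have hdom := hone.mul_prod (hA.mul_prod hB)
  refine Integrable.mono' hdom ?_ (Filter.Eventually.of_forall fun p => ?_)
  · have hw : AEStronglyMeasurable (fun p => (collWeight T p : ℝ)) collMeasure :=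
      (measurable_collWeight T).coe_nnreal_real.aestronglyMeasurable
    exact hw.mul (hX.pow 2)
  · obtain ⟨n, v, w⟩ := p
    have hv := maxwellianT_pos hT v
    have hw := maxwellianT_pos hT w
    have hB : |(inner ℝ (v - w) (n : Velocity) : ℝ)| / 2 ≤ (1 + ‖v‖) * (1 + ‖w‖) := by
      have h1 := abs_real_inner_le_norm (v - w) (n : Velocity)
      rw [norm_eq_of_mem_sphere, mul_one] at h1
      have h2 := norm_sub_le v w
      nlinarith [norm_nonneg v, norm_nonneg w, mul_nonneg (norm_nonneg v) (norm_nonneg w)]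
    have hv1 : (1 + ‖v‖) ≤ (1 + ‖v‖) ^ 2 := by nlinarith [norm_nonneg v]
    rw [NNReal.smul_def, coe_collWeight hT, smul_eq_mul, Real.norm_of_nonneg (by positivity)]
    simp only [collLift]
    have hB' : |(inner ℝ (v - w) (n : Velocity) : ℝ)| / 2 ≤ (1 + ‖v‖) ^ 2 * (1 + ‖w‖) :=
      hB.trans (by gcongr)
    calc _ ≤ (1 + ‖v‖) ^ 2 * (1 + ‖w‖) * (maxwellianT T v * maxwellianT T w)
            * (f v / maxwellianT T v) ^ 2 := by gcongr
      _ = _ := by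
        field_simp

/-- The weak form of the linearized collision operator. -/
theorem innerH_linearizedQ {T : ℝ} (hT : 0 < T) {f g : Velocity → ℝ} (hf : MemDomainL T f)
    (hg : MemDomainL T g) :
    innerH T g (linearizedQ T f) = -(1 / 4) * ∫ p,
      collDiff collSwap collMap (collLift T g) p * collDiff collSwap collMap (collLift T f) p
        ∂(eqCollMeasure T) := by
  have hR := measurePreserving_eqCollMeasure (T := T) measurePreserving_collSwap
    (collWeight_collSwap T)
  have hS := measurePreserving_eqCollMeasure (T := T) measurePreserving_collMap
    (collWeight_collMap T)
  have hX := memLp_collLift hT hf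
  have hY := memLp_collLift hT hg
  rw [← integral_mul_collDiff hR hS collSwap_collSwap collMap_collMap collSwap_collMap hX hY]
  have hint := hY.integrable_mul (memLp_collDiff hR hS hX)
  rw [eqCollMeasure, integrable_withDensity_iff_integrable_smul (measurable_collWeight T)] at hint
  rw [eqCollMeasure, integral_withDensity_eq_integral_smul (measurable_collWeight T), collMeasure]
  simp only [Pi.mul_apply] at hint
  rw [collMeasure] at hint
  rw [integral_prod_symm _ hint, integral_prod _ hint.integral_prod_right, innerH]
  refine integral_congr_ae (Filter.Eventually.of_forall fun v => ?_)
  simp only [linearizedQ, collisionQ]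
  rw [show ∀ a b I : ℝ, a * b * (2 * (1 / 2 * I)) = (a * b) * I by intros; ring,
    ← integral_const_mul]
  refine integral_congr_ae (Filter.Eventually.of_forall fun w => ?_)
  simp only
  rw [← integral_const_mul]
  refine integral_congr_ae (Filter.Eventually.of_forall fun n => ?_)
  simp only [NNReal.smul_def, coe_collWeight hT, smul_eq_mul, collDiff, collLift, collMap,
    collSwap, Prod.fst_swap]
  have hM0 : ∀ v, maxwellianT T v ≠ 0 := fun v => (maxwellianT_pos hT v).ne'
  have e := maxwellianT_preFst_mul_preSnd T v w n
  have h1 := hM0 v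
  have h2 := hM0 w
  have h3 := hM0 (preFst v w n)
  have h4 := hM0 (preSnd v w n)
  have e1 : maxwellianT T v * maxwellianT T w * (f (preFst v w n) / maxwellianT T (preFst v w n))
      = maxwellianT T (preSnd v w n) * f (preFst v w n) := by
    rw [← e]; field_simp
  have e2 : maxwellianT T v * maxwellianT T w * (f (preSnd v w n) / maxwellianT T (preSnd v w n))
      = maxwellianT T (preFst v w n) * f (preSnd v w n) := by
    rw [← e]; field_simp
  have e3 : maxwellianT T v * maxwellianT T w * (f v / maxwellianT T v)
      = maxwellianT T w * f v := by field_simp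
  have e4 : maxwellianT T v * maxwellianT T w * (f w / maxwellianT T w)
      = f w * maxwellianT T v := by field_simp
  linear_combination (-(|(inner ℝ (v - w) (n : Velocity) : ℝ)| / 2) * (g v / maxwellianT T v)) *
    (e1 + e2 - e3 - e4)

theorem innerH_congr_right {T : ℝ} {f g h : Velocity → ℝ} (hgh : g =ᵐ[volume] h) :
    innerH T f g = innerH T f h := by
  refine integral_congr_ae ?_
  filter_upwards [hgh] with v hv
  rw [hv]

/-- The linearized collision operator is symmetric on its domain. -/
theorem innerH_linearizedQ_comm {T : ℝ} (hT : 0 < T) {f g : Velocity → ℝ} (hf : MemDomainL T f)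
    (hg : MemDomainL T g) : innerH T g (linearizedQ T f) = innerH T f (linearizedQ T g) := by
  rw [innerH_linearizedQ hT hf hg, innerH_linearizedQ hT hg hf]
  simp only [mul_comm]

/-- Dissipativity: if `L f = h` with `h` in the domain and of nonzero norm, then `(f, h) < 0`.
If `(f, L f)` vanished, the collision differences of `f` would vanish almost everywhere, whence
`(h, h) = (h, L f) = 0`. -/
theorem innerH_neg_of_linearizedQ {T : ℝ} (hT : 0 < T) {f h : Velocity → ℝ} (hf : MemDomainL T f)
    (hh : MemDomainL T h) (hL : linearizedQ T f =ᵐ[volume] h) (h0 : innerH T h h ≠ 0) :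
    innerH T f h < 0 := by
  have hR := measurePreserving_eqCollMeasure (T := T) measurePreserving_collSwap
    (collWeight_collSwap T)
  have hS := measurePreserving_eqCollMeasure (T := T) measurePreserving_collMap
    (collWeight_collMap T)
  have hZ := memLp_collDiff hR hS (memLp_collLift hT hf)
  have e1 := innerH_linearizedQ hT hf hf
  have e2 := innerH_linearizedQ hT hf hh
  rw [innerH_congr_right hL] at e1 e2
  have hnn : 0 ≤ ∫ p, collDiff collSwap collMap (collLift T f) p
      * collDiff collSwap collMap (collLift T f) p ∂(eqCollMeasure T) :=
    integral_nonneg fun p => mul_self_nonneg _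
  rcases hnn.eq_or_lt with hz | hpos
  · exfalso
    rw [eq_comm, integral_eq_zero_iff_of_nonneg (fun p => mul_self_nonneg _)
      (hZ.integrable_mul hZ)] at hz
    apply h0
    rw [e2, integral_eq_zero_of_ae, mul_zero]
    filter_upwards [hz] with p hp
    have : collDiff collSwap collMap (collLift T f) p = 0 := mul_self_eq_zero.mp hp
    simp [this]
  · rw [e1]
    linarith

/-! ### Dependence of the transport coefficients on the temperature -/

theorem maxwellianT_smul {c : ℝ} (hc : 0 < c) (v : Velocity) :
    maxwellianT (c ^ 2) (c • v) = (c ^ 3)⁻¹ * maxwellianT 1 v := by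
  have h : (2 * Real.pi * c ^ 2) ^ ((3 : ℝ) / 2) = (2 * Real.pi * 1) ^ ((3 : ℝ) / 2) * c ^ 3 := by
    rw [mul_one, Real.mul_rpow (by positivity) (by positivity), ← Real.rpow_natCast c 2,
      ← Real.rpow_mul hc.le, ← Real.rpow_natCast c 3]
    norm_num
  rw [maxwellianT_eq, maxwellianT_eq, h, norm_smul, Real.norm_of_nonneg hc.le, one_div, mul_inv]
  rw [show -((c * ‖v‖) ^ 2) / (2 * c ^ 2) = -(‖v‖ ^ 2) / (2 * 1) by field_simp]
  ring

theorem preFst_smul (c : ℝ) (v w n : Velocity) :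
    preFst (c • v) (c • w) n = c • preFst v w n := by
  simp only [preFst, ← smul_sub, real_inner_smul_left, mul_smul]

theorem preSnd_smul (c : ℝ) (v w n : Velocity) :
    preSnd (c • v) (c • w) n = c • preSnd v w n := by
  simp only [preSnd, ← smul_sub, real_inner_smul_left, mul_smul, smul_add]

theorem integral_velocity_eq_smul {c : ℝ} (hc : 0 < c) (F : Velocity → ℝ) :
    ∫ v, F v = c ^ 3 * ∫ v, F (c • v) := by
  rw [Measure.integral_comp_smul, finrank_euclideanSpace, Fintype.card_fin, smul_eq_mul,
    abs_of_nonneg (by positivity), mul_inv_cancel_left₀ (by positivity)]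

/-- The hard-sphere linearized operator has the homogeneity of a speed. -/
theorem linearizedQ_smul {c : ℝ} (hc : 0 < c) (f : Velocity → ℝ) (v : Velocity) :
    linearizedQ (c ^ 2) f (c • v) = c * linearizedQ 1 (fun v => f (c • v)) v := by
  simp only [linearizedQ, collisionQ]
  rw [integral_velocity_eq_smul hc]
  simp only [preFst_smul, preSnd_smul, maxwellianT_smul hc, ← smul_sub, real_inner_smul_left,
    abs_mul, abs_of_pos hc]
  have h : ∀ w : Velocity, (∫ n : Metric.sphere (0 : Velocity) 1,
      c * |(inner ℝ (v - w) (n : Velocity) : ℝ)| / 2 *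
        ((c ^ 3)⁻¹ * maxwellianT 1 (preSnd v w n) * f (c • preFst v w n)
          + (c ^ 3)⁻¹ * maxwellianT 1 (preFst v w n) * f (c • preSnd v w n)
          - (c ^ 3)⁻¹ * maxwellianT 1 w * f (c • v)
          - f (c • w) * ((c ^ 3)⁻¹ * maxwellianT 1 v)) ∂((volume : Measure Velocity).toSphere))
      = (c * (c ^ 3)⁻¹) * ∫ n : Metric.sphere (0 : Velocity) 1,
      |(inner ℝ (v - w) (n : Velocity) : ℝ)| / 2 *
        (maxwellianT 1 (preSnd v w n) * f (c • preFst v w n)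
          + maxwellianT 1 (preFst v w n) * f (c • preSnd v w n)
          - maxwellianT 1 w * f (c • v)
          - f (c • w) * maxwellianT 1 v) ∂((volume : Measure Velocity).toSphere) := by
    intro w
    rw [← integral_const_mul]
    congr 1
    ext n
    ring
  simp only [h]
  rw [integral_const_mul]
  have e : ∀ I : ℝ, 2 * (1 / 2 * (c ^ 3 * (c * (c ^ 3)⁻¹ * I))) = c * (2 * (1 / 2 * I)) := by
    intro I
    field_simp
  exact e _

theorem memH_comp_smul {c : ℝ} (hc : 0 < c) {f : Velocity → ℝ} (hf : MemH (c ^ 2) f) :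
    MemH 1 (fun v => f (c • v)) := by
  refine ⟨hf.1.comp_quasiMeasurePreserving
    (Measure.quasiMeasurePreserving_smul volume hc.ne'), ?_⟩
  refine ((hf.2.comp_smul hc.ne').const_mul (c ^ 3)⁻¹).congr
    (Filter.Eventually.of_forall fun v => ?_)
  simp only [maxwellianT_smul hc]
  field_simp

theorem MemH.mono {T : ℝ} (hT : 0 < T) {f g : Velocity → ℝ} (hg : MemH T g)
    (hf : AEStronglyMeasurable f (volume : Measure Velocity)) {a : ℝ}
    (h : ∀ v, |f v| ≤ a * |g v|) : MemH T f := by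
  refine ⟨hf, Integrable.mono' (hg.2.const_mul (a ^ 2)) ?_ (Filter.Eventually.of_forall fun v => ?_)⟩
  · exact ((continuous_maxwellianT T).inv₀
      fun v => (maxwellianT_pos hT v).ne').aestronglyMeasurable.mul (hf.pow 2)
  · have hM := maxwellianT_pos hT v
    rw [Real.norm_of_nonneg (by positivity)]
    have h2 : f v ^ 2 ≤ a ^ 2 * g v ^ 2 := by
      rw [← sq_abs (f v), ← sq_abs (g v), ← mul_pow]
      exact pow_le_pow_left₀ (abs_nonneg _) (h v) 2
    calc _ ≤ (maxwellianT T v)⁻¹ * (a ^ 2 * g v ^ 2) := by gcongr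
      _ = _ := by ring

theorem memDomainL_comp_smul {c : ℝ} (hc : 0 < c) {f : Velocity → ℝ} (hf : MemDomainL (c ^ 2) f) :
    MemDomainL 1 (fun v => f (c • v)) := by
  have h1 := memH_comp_smul hc hf.1
  refine ⟨h1, (memH_comp_smul hc hf.2).mono one_pos ?_ (a := 1 + c⁻¹) fun v => ?_⟩
  · exact (continuous_const.add continuous_norm).aestronglyMeasurable.mul h1.1
  · rw [abs_mul, abs_mul, ← mul_assoc]
    gcongr
    rw [abs_of_nonneg (by positivity), abs_of_nonneg (by positivity), norm_smul,
      Real.norm_of_nonneg hc.le]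
    have : c⁻¹ * c = 1 := inv_mul_cancel₀ hc.ne'
    have h2 : 0 < c⁻¹ := by positivity
    nlinarith [norm_nonneg v, mul_nonneg hc.le (norm_nonneg v)]

/-- Solutions of `L f = g` at temperature `c²` and at temperature `1` have comparable pairings with
their sources. By symmetry of the operator no uniqueness of the solutions is needed. -/
theorem innerH_scaling {c : ℝ} (hc : 0 < c) {j : ℕ} {f f₁ g g₁ : Velocity → ℝ}
    (hg : ∀ v, c ^ j * g (c • v) = g₁ v) (hf : MemDomainL (c ^ 2) f) (hf₁ : MemDomainL 1 f₁)
    (hL : linearizedQ (c ^ 2) f =ᵐ[volume] g) (hL₁ : linearizedQ 1 f₁ =ᵐ[volume] g₁) :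
    c ^ (2 * j + 1) * innerH (c ^ 2) f g = c ^ 6 * innerH 1 f₁ g₁ := by
  have hF := memDomainL_comp_smul hc hf
  have hLF : linearizedQ 1 (fun v => f (c • v)) =ᵐ[volume] fun v => (c ^ (j + 1))⁻¹ * g₁ v := by
    have h := (Measure.quasiMeasurePreserving_smul (volume : Measure Velocity) hc.ne').ae_eq_comp hL
    filter_upwards [h] with v hv
    simp only [Function.comp_apply, linearizedQ_smul hc] at hv
    rw [← hg v, ← hv, pow_succ]
    field_simp
  have hsymm := innerH_linearizedQ_comm one_pos hF hf₁
  rw [innerH_congr_right hLF, innerH_congr_right hL₁] at hsymm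
  have e1 : innerH 1 f₁ (fun v => (c ^ (j + 1))⁻¹ * g₁ v)
      = (c ^ (j + 1))⁻¹ * innerH 1 f₁ g₁ := by
    simp only [innerH]
    rw [← integral_const_mul]
    congr 1
    ext v
    ring
  have e2 : innerH (c ^ 2) f g = c ^ 6 * (c ^ j)⁻¹ * innerH 1 (fun v => f (c • v)) g₁ := by
    simp only [innerH]
    rw [integral_velocity_eq_smul hc, ← integral_const_mul, ← integral_const_mul]
    congr 1
    ext v
    rw [maxwellianT_smul hc, ← hg v]
    field_simp
  rw [e2, ← hsymm, e1]
  have : c ^ j ≠ 0 := by positivity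
  field_simp
  ring

theorem integrable_one_add_norm_pow_mul_maxwellianT {T : ℝ} (hT : 0 < T) (k : ℕ) :
    Integrable (fun v : Velocity => (1 + ‖v‖) ^ k * maxwellianT T v) := by
  simp only [add_comm (1 : ℝ), add_pow, one_pow, mul_one, Finset.sum_mul]
  refine integrable_finsetSum _ fun i _ => ?_
  refine ((integrable_norm_pow_mul_maxwellianT hT i).const_mul (k.choose i : ℝ)).congr
    (Filter.Eventually.of_forall fun v => ?_)
  ring

theorem memH_mul_maxwellianT {T : ℝ} (hT : 0 < T) {p : Velocity → ℝ} (hp : Continuous p) {a : ℝ}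
    {k : ℕ} (h : ∀ v, |p v| ≤ a * (1 + ‖v‖) ^ k) : MemH T (fun v => p v * maxwellianT T v) := by
  have hM := continuous_maxwellianT T
  have h1 : MemH T (fun v => (1 + ‖v‖) ^ k * maxwellianT T v) := by
    refine ⟨by fun_prop, ?_⟩
    refine (integrable_one_add_norm_pow_mul_maxwellianT hT (2 * k)).congr
      (Filter.Eventually.of_forall fun v => ?_)
    have := (maxwellianT_pos hT v).ne'
    simp only
    field_simp
    ring
  refine h1.mono hT (by fun_prop) (a := a) fun v => ?_
  rw [abs_mul, abs_mul, ← mul_assoc, abs_of_nonneg (by positivity : 0 ≤ (1 + ‖v‖) ^ k)]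
  gcongr
  exact h v

theorem memDomainL_mul_maxwellianT {T : ℝ} (hT : 0 < T) {p : Velocity → ℝ} (hp : Continuous p)
    {a : ℝ} {k : ℕ} (h : ∀ v, |p v| ≤ a * (1 + ‖v‖) ^ k) :
    MemDomainL T (fun v => p v * maxwellianT T v) := by
  refine ⟨memH_mul_maxwellianT hT hp h, ?_⟩
  simp only [← mul_assoc]
  refine memH_mul_maxwellianT hT (by fun_prop) (a := a) (k := k + 1) fun v => ?_
  rw [abs_mul, abs_of_nonneg (by positivity : 0 ≤ 1 + ‖v‖), pow_succ]
  calc _ ≤ (1 + ‖v‖) * (a * (1 + ‖v‖) ^ k) := by gcongr; exact h v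
    _ = _ := by ring

theorem innerH_self_ne_zero {T : ℝ} (hT : 0 < T) {p : Velocity → ℝ} (hp : Continuous p) {v₀ : Velocity}
    (hv₀ : p v₀ ≠ 0) (h : MemH T (fun v => p v * maxwellianT T v)) :
    innerH T (fun v => p v * maxwellianT T v) (fun v => p v * maxwellianT T v) ≠ 0 := by
  intro h0
  have hM := continuous_maxwellianT T
  have e : ∀ v, (maxwellianT T v)⁻¹ * (p v * maxwellianT T v) * (p v * maxwellianT T v)
      = p v ^ 2 * maxwellianT T v := by
    intro v
    have := (maxwellianT_pos hT v).ne'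
    field_simp
  have hi := h.2
  simp only [sq, ← mul_assoc] at hi
  simp only [innerH, e] at h0
  simp only [← mul_assoc] at e
  simp only [e] at hi
  rw [integral_eq_zero_iff_of_nonneg
    (fun v => mul_nonneg (sq_nonneg _) (maxwellianT_pos hT v).le) hi] at h0
  have h1 := (Continuous.ae_eq_iff_eq (volume : Measure Velocity) ((hp.pow 2).mul hM)
    continuous_zero).mp h0
  have h2 : p v₀ ^ 2 * maxwellianT T v₀ = 0 := congrFun h1 v₀
  simp only [mul_eq_zero, (maxwellianT_pos hT v₀).ne', or_false] at h2
  exact hv₀ (pow_eq_zero_iff (two_ne_zero) |>.mp h2)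

theorem abs_velocity_apply_le (v : Velocity) (i : Fin 3) : |v i| ≤ 1 + ‖v‖ := by
  have := PiLp.norm_apply_le v i
  rw [Real.norm_eq_abs] at this
  linarith

theorem viscosity_one_pos {𝔅 : ℝ → Velocity → ℝ}
    (h𝔅 : ∀ T : ℝ, 0 < T → IsInverseL T (shearSource T) (𝔅 T)) : 0 < viscosity 𝔅 1 := by
  have hp : Continuous fun v : Velocity => v 0 * v 1 / 1 := by fun_prop
  have hdom : MemDomainL 1 (shearSource 1) := by
    refine memDomainL_mul_maxwellianT one_pos hp (a := 1) (k := 2) fun v => ?_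
    rw [div_one, abs_mul, one_mul, sq]
    gcongr <;> exact abs_velocity_apply_le _ _
  have h := innerH_neg_of_linearizedQ one_pos (h𝔅 1 one_pos).mem_domain hdom
    (h𝔅 1 one_pos).equation
    (innerH_self_ne_zero one_pos hp (v₀ := !₂[1, 1, 0]) (by simp) hdom.1)
  simp only [viscosity]
  linarith

theorem conductivity_one_pos {𝔄 : ℝ → Velocity → ℝ}
    (h𝔄 : ∀ T : ℝ, 0 < T → IsInverseL T (heatSource T) (𝔄 T)) : 0 < conductivity 𝔄 1 := by
  have hp : Continuous fun v : Velocity => (‖v‖ ^ 2 - 5 * 1) / (2 * 1 ^ 2) * v 1 := by fun_prop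
  have hdom : MemDomainL 1 (heatSource 1) := by
    refine memDomainL_mul_maxwellianT one_pos hp (a := 5) (k := 3) fun v => ?_
    rw [abs_mul, pow_succ (1 + ‖v‖) 2, ← mul_assoc]
    gcongr
    · rw [abs_le]
      constructor <;> nlinarith [norm_nonneg v]
    · exact abs_velocity_apply_le _ _
  have h := innerH_neg_of_linearizedQ one_pos (h𝔄 1 one_pos).mem_domain hdom
    (h𝔄 1 one_pos).equation
    (innerH_self_ne_zero one_pos hp (v₀ := !₂[0, 1, 0])
      (by
      have h1 : ‖(!₂[0, 1, 0] : Velocity)‖ ^ 2 = 1 := by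
        simp [EuclideanSpace.norm_sq_eq, Fin.sum_univ_three]
      rw [h1]
      norm_num) hdom.1)
  simp only [conductivity]
  linarith

/-- For hard spheres the viscosity is proportional to the square root of the temperature. -/
theorem viscosity_eq_sqrt {𝔅 : ℝ → Velocity → ℝ}
    (h𝔅 : ∀ T : ℝ, 0 < T → IsInverseL T (shearSource T) (𝔅 T)) {T : ℝ} (hT : 0 < T) :
    viscosity 𝔅 T = viscosity 𝔅 1 * √T := by
  obtain ⟨c, hc, rfl⟩ : ∃ c : ℝ, 0 < c ∧ T = c ^ 2 :=
    ⟨√T, Real.sqrt_pos.mpr hT, (Real.sq_sqrt hT.le).symm⟩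
  have h := innerH_scaling hc (j := 3) (f := 𝔅 (c ^ 2)) (f₁ := 𝔅 1) (g := shearSource (c ^ 2))
    (g₁ := shearSource 1) ?_ (h𝔅 _ hT).mem_domain (h𝔅 1 one_pos).mem_domain
    (h𝔅 _ hT).equation (h𝔅 1 one_pos).equation
  · rw [Real.sqrt_sq hc.le]
    simp only [viscosity]
    have h6 : c ^ 6 ≠ 0 := by positivity
    apply mul_left_cancel₀ h6
    linear_combination (-c) * h
  · intro v
    simp only [shearSource, maxwellianT_smul hc, PiLp.smul_apply, smul_eq_mul]
    field_simp

/-- For hard spheres the heat conductivity is proportional to the square root of the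
temperature. -/
theorem conductivity_eq_sqrt {𝔄 : ℝ → Velocity → ℝ}
    (h𝔄 : ∀ T : ℝ, 0 < T → IsInverseL T (heatSource T) (𝔄 T)) {T : ℝ} (hT : 0 < T) :
    conductivity 𝔄 T = conductivity 𝔄 1 * √T := by
  obtain ⟨c, hc, rfl⟩ : ∃ c : ℝ, 0 < c ∧ T = c ^ 2 :=
    ⟨√T, Real.sqrt_pos.mpr hT, (Real.sq_sqrt hT.le).symm⟩
  have h := innerH_scaling hc (j := 4) (f := 𝔄 (c ^ 2)) (f₁ := 𝔄 1) (g := heatSource (c ^ 2))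
    (g₁ := heatSource 1) ?_ (h𝔄 _ hT).mem_domain (h𝔄 1 one_pos).mem_domain
    (h𝔄 _ hT).equation (h𝔄 1 one_pos).equation
  · rw [Real.sqrt_sq hc.le]
    simp only [conductivity]
    have h6 : c ^ 6 ≠ 0 := by positivity
    apply mul_left_cancel₀ h6
    linear_combination (-c) * h
  · intro v
    simp only [heatSource, maxwellianT_smul hc, PiLp.smul_apply, smul_eq_mul, norm_smul,
      Real.norm_of_nonneg hc.le]
    field_simp

/-! ### Functions with constant flux -/

theorem eq_left_of_hasDerivAt_zero {a b : ℝ} {f : ℝ → ℝ} (hf : ContinuousOn f (Icc a b))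
    (hd : ∀ y ∈ Ioo a b, HasDerivAt f 0 y) {y : ℝ} (hy : y ∈ Icc a b) : f y = f a := by
  rcases hy.1.eq_or_lt with h | h
  · rw [h]
  · obtain ⟨c, -, hc⟩ := exists_hasDerivAt_eq_slope f (fun _ => 0) h
      (hf.mono (Icc_subset_Icc_right hy.2)) fun z hz => hd z ⟨hz.1, hz.2.trans_le hy.2⟩
    rw [eq_comm, div_eq_zero_iff] at hc
    rcases hc with hc | hc <;> linarith

/-- A function with constant flux `s f'` and equal end values is constant. -/
theorem eq_left_of_flux_const {a b : ℝ} (hab : a < b) {f f' s : ℝ → ℝ} {k : ℝ}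
    (hf : ContinuousOn f (Icc a b)) (hd : ∀ y ∈ Ioo a b, HasDerivAt f (f' y) y)
    (hs : ∀ y ∈ Ioo a b, s y ≠ 0) (hk : ∀ y ∈ Ioo a b, s y * f' y = k) (h : f a = f b) {y : ℝ}
    (hy : y ∈ Icc a b) : f y = f a := by
  obtain ⟨c, hc, hc0⟩ := exists_hasDerivAt_eq_zero hab hf h hd
  have hk0 : k = 0 := by rw [← hk c hc, hc0, mul_zero]
  refine eq_left_of_hasDerivAt_zero hf (fun z hz => ?_) hy
  have := hk z hz
  rw [hk0, mul_eq_zero] at this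
  rw [← this.resolve_left (hs z hz)]
  exact hd z hz

/-! ### The normalized velocity profile -/

/-- `∫₀ˣ √(1 + ε s (1 - s)) ds`, which is an affine function of `y` along the normalized velocity
profile when the temperature is `1 + ε x (1 - x)`. -/
noncomputable def profileInt (ε x : ℝ) : ℝ := ∫ s in (0 : ℝ)..x, √(1 + ε * (s * (1 - s)))

theorem hasDerivAt_profileInt (ε x : ℝ) :
    HasDerivAt (profileInt ε) (√(1 + ε * (x * (1 - x)))) x := by
  have hc : Continuous fun s : ℝ => √(1 + ε * (s * (1 - s))) := by fun_prop
  exact intervalIntegral.integral_hasDerivAt_right (hc.intervalIntegrable _ _)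
    (hc.stronglyMeasurableAtFilter _ _) hc.continuousAt

theorem continuous_profileInt (ε : ℝ) : Continuous (profileInt ε) :=
  continuous_iff_continuousAt.mpr fun x => (hasDerivAt_profileInt ε x).continuousAt

theorem profileInt_zero (ε : ℝ) : profileInt ε 0 = 0 := by simp [profileInt]

theorem profileTemp_bounds {ε x : ℝ} (hε : 0 ≤ ε) (hx : x ∈ Icc (0 : ℝ) 1) :
    1 ≤ √(1 + ε * (x * (1 - x))) ∧ √(1 + ε * (x * (1 - x))) ≤ 1 + ε := by
  have h1 : 0 ≤ x * (1 - x) := mul_nonneg hx.1 (sub_nonneg.mpr hx.2)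
  have h2 : x * (1 - x) ≤ 1 := by nlinarith [hx.1, hx.2]
  constructor
  · rw [Real.one_le_sqrt]
    nlinarith [mul_nonneg hε h1]
  · rw [Real.sqrt_le_left (by linarith)]
    nlinarith [mul_nonneg hε (sub_nonneg.mpr h2)]

theorem sub_le_profileInt_sub {ε : ℝ} (hε : 0 ≤ ε) {x z : ℝ} (hx : x ∈ Icc (0 : ℝ) 1)
    (hz : z ∈ Icc (0 : ℝ) 1) (hxz : x ≤ z) :
    z - x ≤ profileInt ε z - profileInt ε x := by
  have h := (convex_Icc (0 : ℝ) 1).mul_sub_le_image_sub_of_le_deriv (f := profileInt ε) (C := 1)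
    (continuous_profileInt ε).continuousOn
    (fun y _ => (hasDerivAt_profileInt ε y).differentiableAt.differentiableWithinAt)
    (fun y hy => by
      rw [(hasDerivAt_profileInt ε y).deriv]
      exact (profileTemp_bounds hε (interior_subset hy)).1) x hx z hz hxz
  linarith

theorem profileInt_sub_le {ε : ℝ} (hε : 0 ≤ ε) {x z : ℝ} (hx : x ∈ Icc (0 : ℝ) 1)
    (hz : z ∈ Icc (0 : ℝ) 1) (hxz : x ≤ z) :
    profileInt ε z - profileInt ε x ≤ (1 + ε) * (z - x) :=
  (convex_Icc (0 : ℝ) 1).image_sub_le_mul_sub_of_deriv_le (f := profileInt ε) (C := 1 + ε)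
    (continuous_profileInt ε).continuousOn
    (fun y _ => (hasDerivAt_profileInt ε y).differentiableAt.differentiableWithinAt)
    (fun y hy => by
      rw [(hasDerivAt_profileInt ε y).deriv]
      exact (profileTemp_bounds hε (interior_subset hy)).2) x hx z hz hxz

theorem abs_sub_le_abs_profileInt_sub {ε : ℝ} (hε : 0 ≤ ε) {x z : ℝ} (hx : x ∈ Icc (0 : ℝ) 1)
    (hz : z ∈ Icc (0 : ℝ) 1) : |z - x| ≤ |profileInt ε z - profileInt ε x| := by
  rcases le_total x z with h | h
  · have := sub_le_profileInt_sub hε hx hz h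
    rw [abs_of_nonneg (sub_nonneg.mpr h)]
    exact this.trans (le_abs_self _)
  · have := sub_le_profileInt_sub hε hz hx h
    rw [abs_sub_comm, abs_of_nonneg (sub_nonneg.mpr h), abs_sub_comm (profileInt ε z)]
    exact this.trans (le_abs_self _)

theorem profileInt_injOn {ε : ℝ} (hε : 0 ≤ ε) : InjOn (profileInt ε) (Icc 0 1) := by
  intro x hx z hz h
  have := abs_sub_le_abs_profileInt_sub hε hx hz
  rw [h, sub_self, abs_zero] at this
  linarith [abs_eq_zero.mp (le_antisymm this (abs_nonneg _))]

/-- `x` is the profile of the tangential velocity, normalized to rise from `0` to `1` across the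
channel, when the temperature is `1 + ε x (1 - x)` and `√T x'` is constant. -/
structure IsProfile (ε : ℝ) (x : ℝ → ℝ) : Prop where
  mem : ∀ y ∈ Icc (-Real.pi) Real.pi, x y ∈ Icc (0 : ℝ) 1
  eq : ∀ y ∈ Icc (-Real.pi) Real.pi,
    profileInt ε (x y) = profileInt ε 1 * ((y + Real.pi) / (2 * Real.pi))

theorem exists_isProfile {ε : ℝ} (hε : 0 ≤ ε) : ∃ x : ℝ → ℝ, IsProfile ε x := by
  have h1 := sub_le_profileInt_sub hε (left_mem_Icc.mpr zero_le_one)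
    (right_mem_Icc.mpr zero_le_one) zero_le_one
  rw [profileInt_zero] at h1
  have h : ∀ y : ℝ, ∃ x : ℝ, y ∈ Icc (-Real.pi) Real.pi → x ∈ Icc (0 : ℝ) 1 ∧
      profileInt ε x = profileInt ε 1 * ((y + Real.pi) / (2 * Real.pi)) := by
    intro y
    by_cases hy : y ∈ Icc (-Real.pi) Real.pi
    · have hπ := Real.pi_pos
      have h2 : (y + Real.pi) / (2 * Real.pi) ≤ 1 := by
        rw [div_le_one (by positivity)]
        linarith [hy.2]
      have h3 : 0 ≤ (y + Real.pi) / (2 * Real.pi) := div_nonneg (by linarith [hy.1]) (by positivity)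
      obtain ⟨x, hx, hxe⟩ := intermediate_value_Icc (zero_le_one (α := ℝ))
        (continuous_profileInt ε).continuousOn
        (show profileInt ε 1 * ((y + Real.pi) / (2 * Real.pi)) ∈ _ from by
          rw [profileInt_zero]
          exact ⟨mul_nonneg (by linarith) h3, mul_le_of_le_one_right (by linarith) h2⟩)
      exact ⟨x, fun _ => ⟨hx, hxe⟩⟩
    · exact ⟨0, fun h => absurd h hy⟩
  choose x hx using h
  exact ⟨x, fun y hy => (hx y hy).1, fun y hy => (hx y hy).2⟩

namespace IsProfile

variable {ε : ℝ} {x : ℝ → ℝ}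

theorem left (h : IsProfile ε x) (hε : 0 ≤ ε) : x (-Real.pi) = 0 := by
  have hm : -Real.pi ∈ Icc (-Real.pi) Real.pi := left_mem_Icc.mpr (by linarith [Real.pi_pos])
  apply profileInt_injOn hε (h.mem _ hm) (left_mem_Icc.mpr zero_le_one)
  rw [h.eq _ hm, profileInt_zero]
  simp

theorem right (h : IsProfile ε x) (hε : 0 ≤ ε) : x Real.pi = 1 := by
  have hm : Real.pi ∈ Icc (-Real.pi) Real.pi := right_mem_Icc.mpr (by linarith [Real.pi_pos])
  apply profileInt_injOn hε (h.mem _ hm) (right_mem_Icc.mpr zero_le_one)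
  rw [h.eq _ hm, ← two_mul, div_self (by positivity), mul_one]

theorem continuousOn (h : IsProfile ε x) (hε : 0 ≤ ε) :
    ContinuousOn x (Icc (-Real.pi) Real.pi) := by
  refine (LipschitzOnWith.of_dist_le_mul
    (K := Real.toNNReal |profileInt ε 1 / (2 * Real.pi)|) fun y hy z hz => ?_).continuousOn
  rw [Real.coe_toNNReal _ (abs_nonneg _), Real.dist_eq, Real.dist_eq, ← abs_mul]
  refine (abs_sub_le_abs_profileInt_sub hε (h.mem z hz) (h.mem y hy)).trans_eq ?_
  rw [h.eq y hy, h.eq z hz]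
  congr 1
  ring

theorem temp_pos (h : IsProfile ε x) (hε : 0 ≤ ε) {y : ℝ} (hy : y ∈ Icc (-Real.pi) Real.pi) :
    0 < 1 + ε * (x y * (1 - x y)) := by
  have := mul_nonneg hε (mul_nonneg (h.mem y hy).1 (sub_nonneg.mpr (h.mem y hy).2))
  linarith

theorem hasDerivAt (h : IsProfile ε x) (hε : 0 ≤ ε) {y : ℝ} (hy : y ∈ Ioo (-Real.pi) Real.pi) :
    HasDerivAt x (profileInt ε 1 / (2 * Real.pi) / √(1 + ε * (x y * (1 - x y)))) y := by
  have hπ := Real.pi_pos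
  have h1 := sub_le_profileInt_sub hε (left_mem_Icc.mpr zero_le_one)
    (right_mem_Icc.mpr zero_le_one) zero_le_one
  rw [profileInt_zero] at h1
  have hc : 0 < profileInt ε 1 / (2 * Real.pi) := by
    have : 0 < profileInt ε 1 := by linarith
    positivity
  have hs := (profileTemp_bounds hε (h.mem y (Ioo_subset_Icc_self hy))).1
  have hcont : ContinuousAt x y := (h.continuousOn hε).continuousAt (Icc_mem_nhds hy.1 hy.2)
  -- `x` is a local inverse of the increasing function `profileInt ε / c - π`
  have hG : HasDerivAt (fun z => profileInt ε z / (profileInt ε 1 / (2 * Real.pi)) - Real.pi)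
      (√(1 + ε * (x y * (1 - x y))) / (profileInt ε 1 / (2 * Real.pi))) (x y) :=
    ((hasDerivAt_profileInt ε (x y)).div_const _).sub_const _
  have hloc := HasDerivAt.of_local_left_inverse hcont hG (by positivity) (by
    filter_upwards [Icc_mem_nhds hy.1 hy.2] with z hz
    rw [h.eq z hz]
    have h2 : profileInt ε 1 ≠ 0 := by linarith
    field_simp
    ring)
  rwa [inv_div] at hloc

theorem contDiffOn (h : IsProfile ε x) (hε : 0 ≤ ε) :
    ContDiffOn ℝ ∞ x (Ioo (-Real.pi) Real.pi) := by
  rw [contDiffOn_infty]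
  intro n
  -- the differential equation gains one derivative at a time
  induction n with
  | zero =>
    rw [Nat.cast_zero, contDiffOn_zero]
    exact (h.continuousOn hε).mono Ioo_subset_Icc_self
  | succ n ih =>
    rw [Nat.cast_succ, contDiffOn_succ_iff_deriv_of_isOpen isOpen_Ioo]
    refine ⟨fun y hy => (h.hasDerivAt hε hy).differentiableAt.differentiableWithinAt,
      fun hn => by simp at hn, ?_⟩
    have hs : ContDiffOn ℝ n (fun y => √(1 + ε * (x y * (1 - x y)))) (Ioo (-Real.pi) Real.pi) :=
      (contDiffOn_const.add (contDiffOn_const.mul (ih.mul (contDiffOn_const.sub ih)))).sqrt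
        fun y hy => (h.temp_pos hε (Ioo_subset_Icc_self hy)).ne'
    refine (ContDiffOn.div (contDiffOn_const (c := profileInt ε 1 / (2 * Real.pi))) hs
      fun y hy => ?_).congr fun y hy => (h.hasDerivAt hε hy).deriv
    exact (Real.sqrt_pos.mpr (h.temp_pos hε (Ioo_subset_Icc_self hy))).ne'

theorem abs_sub_le (h : IsProfile ε x) (hε : 0 ≤ ε) {y : ℝ} (hy : y ∈ Icc (-Real.pi) Real.pi) :
    |x y - (y + Real.pi) / (2 * Real.pi)| ≤ ε := by
  have hπ := Real.pi_pos
  have h0 : (0 : ℝ) ∈ Icc (0 : ℝ) 1 := left_mem_Icc.mpr zero_le_one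
  have h1 : (1 : ℝ) ∈ Icc (0 : ℝ) 1 := right_mem_Icc.mpr zero_le_one
  have hx := h.mem y hy
  have e := h.eq y hy
  have a1 := sub_le_profileInt_sub hε h0 h1 zero_le_one
  have a2 := profileInt_sub_le hε h0 h1 zero_le_one
  have b1 := sub_le_profileInt_sub hε h0 hx hx.1
  have b2 := profileInt_sub_le hε h0 hx hx.1
  rw [profileInt_zero] at a1 a2 b1 b2
  have h2 : (y + Real.pi) / (2 * Real.pi) ≤ 1 := by
    rw [div_le_one (by positivity)]
    linarith [hy.2]
  have h3 : 0 ≤ (y + Real.pi) / (2 * Real.pi) := div_nonneg (by linarith [hy.1]) (by positivity)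
  generalize (y + Real.pi) / (2 * Real.pi) = t at *
  rw [e] at b1 b2
  rw [abs_le]
  constructor
  · nlinarith [mul_nonneg (sub_nonneg.mpr a1) h3, mul_nonneg hε (sub_nonneg.mpr hx.2)]
  · nlinarith [mul_nonneg (sub_nonneg.mpr a2) h3, mul_nonneg hε (sub_nonneg.mpr h2)]

theorem slope_bounds (h : IsProfile ε x) (hε : 0 ≤ ε) {y : ℝ} (hy : y ∈ Icc (-Real.pi) Real.pi) :
    |profileInt ε 1 / (2 * Real.pi) / √(1 + ε * (x y * (1 - x y))) - 1 / (2 * Real.pi)| ≤ ε := by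
  have hπ := Real.pi_gt_three
  have h0 : (0 : ℝ) ∈ Icc (0 : ℝ) 1 := left_mem_Icc.mpr zero_le_one
  have h1 : (1 : ℝ) ∈ Icc (0 : ℝ) 1 := right_mem_Icc.mpr zero_le_one
  have a1 := sub_le_profileInt_sub hε h0 h1 zero_le_one
  have a2 := profileInt_sub_le hε h0 h1 zero_le_one
  rw [profileInt_zero] at a1 a2
  obtain ⟨s1, s2⟩ := profileTemp_bounds hε (h.mem y hy)
  generalize √(1 + ε * (x y * (1 - x y))) = s at *
  generalize profileInt ε 1 = g at *
  have hs : 0 < s := by linarith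
  have e : g / (2 * Real.pi) / s - 1 / (2 * Real.pi) = (g - s) / (2 * Real.pi * s) := by
    field_simp
  rw [e, abs_div, abs_of_pos (by positivity : 0 < 2 * Real.pi * s), div_le_iff₀ (by positivity)]
  have h4 : |g - s| ≤ ε := by
    rw [abs_le]
    constructor <;> linarith
  have h5 : 1 ≤ 2 * Real.pi * s := by nlinarith
  nlinarith

end IsProfile

/-- A function rising from `0` to `1` with constant flux `√T z'`, where `T = 1 + ε z (1 - z)`, is
the profile. -/
theorem isProfile_of_flux_const {ε k : ℝ} {z z' : ℝ → ℝ}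
    (hz : ContinuousOn z (Icc (-Real.pi) Real.pi))
    (hd : ∀ y ∈ Ioo (-Real.pi) Real.pi, HasDerivAt z (z' y) y)
    (hT : ∀ y ∈ Ioo (-Real.pi) Real.pi, 0 < 1 + ε * (z y * (1 - z y)))
    (hk : ∀ y ∈ Ioo (-Real.pi) Real.pi, √(1 + ε * (z y * (1 - z y))) * z' y = k)
    (h0 : z (-Real.pi) = 0) (h1 : z Real.pi = 1) : IsProfile ε z := by
  have hπ := Real.pi_pos
  have hlt : -Real.pi < Real.pi := by linarith
  have hkpos : 0 < k := by
    obtain ⟨c, hc, hce⟩ := exists_hasDerivAt_eq_slope z z' hlt hz hd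
    rw [← hk c hc, hce, h0, h1]
    have := Real.sqrt_pos.mpr (hT c hc)
    have h2 : (1 - 0) / (Real.pi - -Real.pi) = 1 / (2 * Real.pi) := by
      congr 1 <;> ring
    rw [h2]
    positivity
  have hz'pos : ∀ y ∈ Ioo (-Real.pi) Real.pi, 0 < z' y := by
    intro y hy
    have h2 := hk y hy
    exact pos_of_mul_pos_right (h2 ▸ hkpos) (Real.sqrt_nonneg _)
  have hmono : MonotoneOn z (Icc (-Real.pi) Real.pi) := by
    refine monotoneOn_of_deriv_nonneg (convex_Icc _ _) hz ?_ ?_ <;> rw [interior_Icc]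
    · exact fun y hy => (hd y hy).differentiableAt.differentiableWithinAt
    · intro y hy
      rw [(hd y hy).deriv]
      exact (hz'pos y hy).le
  have hl : -Real.pi ∈ Icc (-Real.pi) Real.pi := left_mem_Icc.mpr hlt.le
  have hr : Real.pi ∈ Icc (-Real.pi) Real.pi := right_mem_Icc.mpr hlt.le
  have hlin : ∀ y ∈ Icc (-Real.pi) Real.pi, profileInt ε (z y) - k * y = k * Real.pi := by
    intro y hy
    have hc : ContinuousOn (fun y => profileInt ε (z y) - k * y) (Icc (-Real.pi) Real.pi) :=
      ((continuous_profileInt ε).comp_continuousOn hz).sub (by fun_prop)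
    rw [eq_left_of_hasDerivAt_zero hc (fun w hw => ?_) hy, h0, profileInt_zero]
    · ring
    · have h2 := ((hasDerivAt_profileInt ε (z w)).comp w (hd w hw)).sub
        ((hasDerivAt_id w).const_mul k)
      rw [hk w hw, mul_one, sub_self] at h2
      exact h2
  refine ⟨fun y hy => ⟨h0 ▸ hmono hl hy hy.1, h1 ▸ hmono hy hr hy.2⟩, fun y hy => ?_⟩
  have e1 := hlin y hy
  have e2 := hlin Real.pi hr
  rw [h1] at e2
  rw [eq_add_of_sub_eq e1, eq_add_of_sub_eq e2]
  field_simp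
  ring

theorem IsProfile.eqOn {ε : ℝ} (hε : 0 ≤ ε) {x z : ℝ → ℝ} (hx : IsProfile ε x)
    (hz : IsProfile ε z) : EqOn x z (Icc (-Real.pi) Real.pi) := fun y hy =>
  profileInt_injOn hε (hx.mem y hy) (hz.mem y hy) (by rw [hx.eq y hy, hz.eq y hy])

/-! ### Explicit solution -/

/-- The coefficient `η₀ (U₊ - U₋)² / (2 κ₀)` of viscous heating: the temperature is
`1 + δ² q x (1 - x)` along the normalized velocity profile `x`. -/
noncomputable def heatingCoeff (η₀ κ₀ Uminus Uplus : ℝ) : ℝ := η₀ * (Uplus - Uminus) ^ 2 / (2 * κ₀)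

/-- The part of the radial momentum flux that comes from the higher-order stresses. -/
noncomputable def normalStress (σ₁ σ₂ : ℝ → ℝ) (δ : ℝ) (U τ r : ℝ → ℝ) (s : ℝ) : ℝ :=
  δ ^ 2 / ((1 + δ * r s) * (1 + δ * τ s)) *
    (σ₁ (1 + δ * τ s) * deriv τ s ^ 2 + σ₂ (1 + δ * τ s) * deriv U s ^ 2)

theorem contDiffOn_deriv_Ioo {a b : ℝ} {f : ℝ → ℝ} (hf : ContDiffOn ℝ ∞ f (Ioo a b)) :
    ContDiffOn ℝ ∞ (deriv f) (Ioo a b) :=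
  ((contDiffOn_infty_iff_deriv_of_isOpen isOpen_Ioo).mp hf).2

theorem ContDiffOn.hasDerivAt_Ioo {a b : ℝ} {f : ℝ → ℝ} (hf : ContDiffOn ℝ ∞ f (Ioo a b)) {y : ℝ}
    (hy : y ∈ Ioo a b) : HasDerivAt f (deriv f y) y :=
  ((hf.differentiableOn (by simp)).differentiableAt (isOpen_Ioo.mem_nhds hy)).hasDerivAt

theorem exists_smooth_primitive {a b : ℝ} {f : ℝ → ℝ} (hab : a < b)
    (hf : ContDiffOn ℝ ∞ f (Ioo a b)) :
    ∃ F : ℝ → ℝ, ContDiffOn ℝ ∞ F (Ioo a b) ∧ ∀ y ∈ Ioo a b, HasDerivAt F (f y) y := by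
  have hm : (a + b) / 2 ∈ Ioo a b := ⟨by linarith, by linarith⟩
  have hd : ∀ y ∈ Ioo a b, HasDerivAt (fun y => ∫ s in ((a + b) / 2)..y, f s) (f y) y := by
    intro y hy
    refine intervalIntegral.integral_hasDerivAt_right ?_ ?_ ?_
    · exact (hf.continuousOn.mono (ordConnected_Ioo.uIcc_subset hm hy)).intervalIntegrable
    · exact hf.continuousOn.stronglyMeasurableAtFilter isOpen_Ioo y hy
    · exact hf.continuousOn.continuousAt (isOpen_Ioo.mem_nhds hy)
  refine ⟨_, (contDiffOn_infty_iff_deriv_of_isOpen isOpen_Ioo).mpr ⟨?_, ?_⟩, hd⟩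
  · exact fun y hy => (hd y hy).differentiableAt.differentiableWithinAt
  · exact hf.congr fun y hy => (hd y hy).deriv

theorem contDiffOn_normalStress {σ₁ σ₂ : ℝ → ℝ} (hσ₁ : ContDiffOn ℝ ∞ σ₁ (Ioi 0))
    (hσ₂ : ContDiffOn ℝ ∞ σ₂ (Ioi 0)) {δ a b : ℝ} {U τ r : ℝ → ℝ}
    (hU : ContDiffOn ℝ ∞ U (Ioo a b)) (hτ : ContDiffOn ℝ ∞ τ (Ioo a b))
    (hr : ContDiffOn ℝ ∞ r (Ioo a b)) (hT : ∀ y ∈ Ioo a b, 0 < 1 + δ * τ y)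
    (hρ : ∀ y ∈ Ioo a b, (1 + δ * r y) * (1 + δ * τ y) ≠ 0) :
    ContDiffOn ℝ ∞ (normalStress σ₁ σ₂ δ U τ r) (Ioo a b) := by
  have hTs : ContDiffOn ℝ ∞ (fun s => 1 + δ * τ s) (Ioo a b) :=
    contDiffOn_const.add (contDiffOn_const.mul hτ)
  have hρs : ContDiffOn ℝ ∞ (fun s => 1 + δ * r s) (Ioo a b) :=
    contDiffOn_const.add (contDiffOn_const.mul hr)
  exact (contDiffOn_const.div (hρs.mul hTs) hρ).mul
    (((hσ₁.comp hTs hT).mul ((contDiffOn_deriv_Ioo hτ).pow 2)).add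
      ((hσ₂.comp hTs hT).mul ((contDiffOn_deriv_Ioo hU).pow 2)))

/-- The temperature field attached to the normalized velocity profile `x`. -/
noncomputable def profileTau (q δ : ℝ) (x : ℝ → ℝ) (y : ℝ) : ℝ := δ * q * (x y * (1 - x y))

/-- The density field that makes the pressure constant. -/
noncomputable def densityOf (δ : ℝ) (τ : ℝ → ℝ) (y : ℝ) : ℝ := ((1 + δ * τ y)⁻¹ - 1) / δ

theorem one_add_mul_densityOf {δ : ℝ} (hδ : δ ≠ 0) (τ : ℝ → ℝ) (y : ℝ) :
    1 + δ * densityOf δ τ y = (1 + δ * τ y)⁻¹ := by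
  rw [densityOf, mul_div_cancel₀ _ hδ]
  ring

theorem one_add_mul_profileTau (q δ : ℝ) (x : ℝ → ℝ) (y : ℝ) :
    1 + δ * profileTau q δ x y = 1 + δ ^ 2 * q * (x y * (1 - x y)) := by
  rw [profileTau]
  ring

/-- Along the profile the energy equation balances the viscous heating, because viscosity and
conductivity are proportional. -/
theorem exists_isHDSolution {η κ σ₁ σ₂ : ℝ → ℝ} {η₀ κ₀ : ℝ} (hη₀ : 0 < η₀) (hκ₀ : 0 < κ₀)
    (hη : ∀ T, 0 < T → η T = η₀ * √T) (hκ : ∀ T, 0 < T → κ T = κ₀ * √T)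
    (hσ₁ : ContDiffOn ℝ ∞ σ₁ (Ioi 0)) (hσ₂ : ContDiffOn ℝ ∞ σ₂ (Ioi 0))
    (C Uminus Uplus : ℝ) {δ : ℝ} (hδ : 0 < δ) {x : ℝ → ℝ}
    (hx : IsProfile (δ ^ 2 * heatingCoeff η₀ κ₀ Uminus Uplus) x) :
    ∃ P : ℝ → ℝ, IsHDSolution η κ σ₁ σ₂ C Uminus Uplus δ
      (fun y => Uminus + (Uplus - Uminus) * x y) (fun _ => 0)
      (profileTau (heatingCoeff η₀ κ₀ Uminus Uplus) δ x)
      (densityOf δ (profileTau (heatingCoeff η₀ κ₀ Uminus Uplus) δ x)) P := by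
  have hq : 2 * κ₀ * heatingCoeff η₀ κ₀ Uminus Uplus = η₀ * (Uplus - Uminus) ^ 2 := by
    rw [heatingCoeff]
    field_simp
  have hq0 : 0 ≤ heatingCoeff η₀ κ₀ Uminus Uplus := by
    rw [heatingCoeff]
    positivity
  generalize heatingCoeff η₀ κ₀ Uminus Uplus = q at *
  have hε : 0 ≤ δ ^ 2 * q := by positivity
  set U : ℝ → ℝ := fun y => Uminus + (Uplus - Uminus) * x y with hUdef
  set τ : ℝ → ℝ := profileTau q δ x with hτdef
  set r : ℝ → ℝ := densityOf δ τ with hrdef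
  set c : ℝ := profileInt (δ ^ 2 * q) 1 / (2 * Real.pi) with hcdef
  have hTpos : ∀ y ∈ Icc (-Real.pi) Real.pi, 0 < 1 + δ * τ y := fun y hy => by
    rw [hτdef, one_add_mul_profileTau]
    exact hx.temp_pos hε hy
  have hTpos' : ∀ y ∈ Ioo (-Real.pi) Real.pi, 0 < 1 + δ * τ y := fun y hy =>
    hTpos y (Ioo_subset_Icc_self hy)
  have hρT : ∀ y ∈ Icc (-Real.pi) Real.pi, (1 + δ * r y) * (1 + δ * τ y) = 1 := fun y hy => by
    rw [hrdef, one_add_mul_densityOf hδ.ne']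
    exact inv_mul_cancel₀ (hTpos y hy).ne'
  have hxs := hx.contDiffOn hε
  have hxc := hx.continuousOn hε
  have hx' : ∀ y ∈ Ioo (-Real.pi) Real.pi, HasDerivAt x (c / √(1 + δ * τ y)) y := fun y hy => by
    rw [hτdef, one_add_mul_profileTau]
    exact hx.hasDerivAt hε hy
  have hUs : ContDiffOn ℝ ∞ U (Ioo (-Real.pi) Real.pi) :=
    contDiffOn_const.add (contDiffOn_const.mul hxs)
  have hτs : ContDiffOn ℝ ∞ τ (Ioo (-Real.pi) Real.pi) :=
    contDiffOn_const.mul (hxs.mul (contDiffOn_const.sub hxs))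
  have hrs : ContDiffOn ℝ ∞ r (Ioo (-Real.pi) Real.pi) :=
    (((contDiffOn_const.add (contDiffOn_const.mul hτs)).inv
      fun y hy => (hTpos' y hy).ne').sub contDiffOn_const).div_const δ
  have hUc : ContinuousOn U (Icc (-Real.pi) Real.pi) :=
    continuousOn_const.add (continuousOn_const.mul hxc)
  have hτc : ContinuousOn τ (Icc (-Real.pi) Real.pi) :=
    continuousOn_const.mul (hxc.mul (continuousOn_const.sub hxc))
  have hrc : ContinuousOn r (Icc (-Real.pi) Real.pi) :=
    (((continuousOn_const.add (continuousOn_const.mul hτc)).inv₀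
      fun y hy => (hTpos y hy).ne').sub continuousOn_const).div_const δ
  have hU' : ∀ y ∈ Ioo (-Real.pi) Real.pi,
      deriv U y = (Uplus - Uminus) * (c / √(1 + δ * τ y)) := fun y hy =>
    (((hx' y hy).const_mul _).const_add _).deriv
  have hτ' : ∀ y ∈ Ioo (-Real.pi) Real.pi,
      deriv τ y = δ * q * ((1 - 2 * x y) * (c / √(1 + δ * τ y))) := fun y hy => by
    have h := ((hx' y hy).mul ((hx' y hy).const_sub 1)).const_mul (δ * q)
    refine h.deriv.trans ?_
    ring
  have hWs := contDiffOn_normalStress hσ₁ hσ₂ hUs hτs hrs hTpos' fun y hy => by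
    rw [hρT y (Ioo_subset_Icc_self hy)]
    exact one_ne_zero
  have hcent : ContDiffOn ℝ ∞ (fun y => 1 / C ^ 2 * (1 + δ * r y) * U y ^ 2)
      (Ioo (-Real.pi) Real.pi) :=
    (contDiffOn_const.mul (contDiffOn_const.add (contDiffOn_const.mul hrs))).mul (hUs.pow 2)
  obtain ⟨F, hFs, hF'⟩ := exists_smooth_primitive (by linarith [Real.pi_pos]) hcent
  have hτl : τ (-Real.pi) = 0 := by simp [hτdef, profileTau, hx.left hε]
  have hτr : τ Real.pi = 0 := by simp [hτdef, profileTau, hx.right hε]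
  refine ⟨fun y => F y + normalStress σ₁ σ₂ δ U τ r y, ?_⟩
  exact
    { smooth_U := hUs
      smooth_u := contDiffOn_const
      smooth_τ := hτs
      smooth_r := hrs
      smooth_P := hFs.add hWs
      cont_U := hUc
      cont_u := continuousOn_const
      cont_τ := hτc
      cont_r := hrc
      mass := fun y _ => by simp
      pressure := fun y hy => by
        have h : (fun s => (1 + δ * r s) * (1 + δ * τ s)) =ᶠ[nhds y] fun _ => 1 := by
          filter_upwards [isOpen_Ioo.mem_nhds hy] with s hs
          exact hρT s (Ioo_subset_Icc_self hs)
        rw [h.deriv_eq, deriv_const]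
      tangential := fun y hy => by
        have h : (fun s => η (1 + δ * τ s) * deriv U s) =ᶠ[nhds y]
            fun _ => η₀ * ((Uplus - Uminus) * c) := by
          filter_upwards [isOpen_Ioo.mem_nhds hy] with s hs
          have := Real.sqrt_pos.mpr (hTpos' s hs)
          rw [hη _ (hTpos' s hs), hU' s hs]
          field_simp
        rw [h.deriv_eq, deriv_const]
        ring
      energy := fun y hy => by
        have h : (fun s => κ (1 + δ * τ s) * deriv τ s) =ᶠ[nhds y]
            fun s => κ₀ * δ * q * c * (1 - 2 * x s) := by
          filter_upwards [isOpen_Ioo.mem_nhds hy] with s hs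
          have := Real.sqrt_pos.mpr (hTpos' s hs)
          rw [hκ _ (hTpos' s hs), hτ' s hs]
          field_simp
        rw [h.deriv_eq, ((((hx' y hy).const_mul 2).const_sub 1).const_mul _).deriv,
          hη _ (hTpos' y hy), hU' y hy]
        have := Real.sqrt_pos.mpr (hTpos' y hy)
        field_simp
        linear_combination (2 * δ * c ^ 2) * hq
      radial := fun y hy => by
        simp only [deriv_const', mul_zero, zero_add]
        have h1 : deriv (fun y => F y + normalStress σ₁ σ₂ δ U τ r y) y
            = 1 / C ^ 2 * (1 + δ * r y) * U y ^ 2 + deriv (normalStress σ₁ σ₂ δ U τ r) y :=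
          ((hF' y hy).add (hWs.hasDerivAt_Ioo hy)).deriv
        rw [h1, add_sub_cancel_left]
        rfl
      u_left := rfl
      u_right := rfl
      U_left := by simp [hUdef, hx.left hε]
      U_right := by simp [hUdef, hx.right hε]
      τ_left := hτl
      τ_right := hτr
      r_left := by simp [hrdef, densityOf, hτl]
      r_right := by simp [hrdef, densityOf, hτr] }

/-! ### Every solution is explicit -/

namespace IsHDSolution

variable {η κ σ₁ σ₂ : ℝ → ℝ} {C Uminus Uplus δ : ℝ} {U u τ r P : ℝ → ℝ}

theorem density_mul_temp (h : IsHDSolution η κ σ₁ σ₂ C Uminus Uplus δ U u τ r P) {y : ℝ}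
    (hy : y ∈ Icc (-Real.pi) Real.pi) : (1 + δ * r y) * (1 + δ * τ y) = 1 := by
  have hc : ContinuousOn (fun s => (1 + δ * r s) * (1 + δ * τ s)) (Icc (-Real.pi) Real.pi) :=
    (continuousOn_const.add (continuousOn_const.mul h.cont_r)).mul
      (continuousOn_const.add (continuousOn_const.mul h.cont_τ))
  rw [eq_left_of_hasDerivAt_zero hc (fun z hz => ?_) hy, h.r_left, h.τ_left]
  · ring
  · rw [← h.pressure z hz]
    exact ((((h.smooth_r.hasDerivAt_Ioo hz).const_mul δ).const_add 1).mul
      (((h.smooth_τ.hasDerivAt_Ioo hz).const_mul δ).const_add 1)).differentiableAt.hasDerivAt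

theorem temp_pos (h : IsHDSolution η κ σ₁ σ₂ C Uminus Uplus δ U u τ r P) {y : ℝ}
    (hy : y ∈ Icc (-Real.pi) Real.pi) : 0 < 1 + δ * τ y := by
  by_contra hneg
  rw [not_lt] at hneg
  have hl : -Real.pi ∈ Icc (-Real.pi) Real.pi := left_mem_Icc.mpr (hy.1.trans hy.2)
  have hc : ContinuousOn (fun s => 1 + δ * τ s) (Icc (-Real.pi) Real.pi) :=
    continuousOn_const.add (continuousOn_const.mul h.cont_τ)
  obtain ⟨z, hz, hz0⟩ := isPreconnected_Icc.intermediate_value hy hl hc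
    (show (0 : ℝ) ∈ Icc _ _ from ⟨hneg, by rw [h.τ_left]; norm_num⟩)
  have := h.density_mul_temp hz
  simp only at hz0
  rw [hz0, mul_zero] at this
  exact zero_ne_one this

theorem velocity_eq_zero (h : IsHDSolution η κ σ₁ σ₂ C Uminus Uplus δ U u τ r P) {y : ℝ}
    (hy : y ∈ Icc (-Real.pi) Real.pi) : u y = 0 := by
  have hc : ContinuousOn (fun s => (1 + δ * r s) * u s) (Icc (-Real.pi) Real.pi) :=
    (continuousOn_const.add (continuousOn_const.mul h.cont_r)).mul h.cont_u
  have e := eq_left_of_hasDerivAt_zero hc (fun z hz => ?_) hy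
  · simp only [h.u_left, mul_zero, mul_eq_zero] at e
    refine e.resolve_left fun h0 => ?_
    have := h.density_mul_temp hy
    rw [h0, zero_mul] at this
    exact zero_ne_one this
  · rw [← h.mass z hz]
    exact ((((h.smooth_r.hasDerivAt_Ioo hz).const_mul δ).const_add 1).mul
      (h.smooth_u.hasDerivAt_Ioo hz)).differentiableAt.hasDerivAt

theorem density_eq (h : IsHDSolution η κ σ₁ σ₂ C Uminus Uplus δ U u τ r P) (hδ : δ ≠ 0) {y : ℝ}
    (hy : y ∈ Icc (-Real.pi) Real.pi) : r y = densityOf δ τ y := by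
  have h1 : 1 + δ * r y = 1 + δ * densityOf δ τ y := by
    rw [one_add_mul_densityOf hδ]
    exact eq_inv_of_mul_eq_one_left (h.density_mul_temp hy)
  exact mul_left_cancel₀ hδ (add_left_cancel h1)

theorem contDiffOn_sqrt_temp (h : IsHDSolution η κ σ₁ σ₂ C Uminus Uplus δ U u τ r P) :
    ContDiffOn ℝ ∞ (fun y => √(1 + δ * τ y)) (Ioo (-Real.pi) Real.pi) :=
  (contDiffOn_const.add (contDiffOn_const.mul h.smooth_τ)).sqrt
    fun _ hy => (h.temp_pos (Ioo_subset_Icc_self hy)).ne'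

/-- The shear stress is constant. -/
theorem exists_shear_flux (h : IsHDSolution η κ σ₁ σ₂ C Uminus Uplus δ U u τ r P) {η₀ : ℝ}
    (hη₀ : 0 < η₀) (hη : ∀ T, 0 < T → η T = η₀ * √T) :
    ∃ k : ℝ, ∀ y ∈ Ioo (-Real.pi) Real.pi, √(1 + δ * τ y) * deriv U y = k := by
  have h0 : (0 : ℝ) ∈ Ioo (-Real.pi) Real.pi := by simp [Real.pi_pos]
  have hs := h.contDiffOn_sqrt_temp.mul (contDiffOn_deriv_Ioo h.smooth_U)
  refine ⟨_, fun y hy => isOpen_Ioo.is_const_of_deriv_eq_zero isPreconnected_Ioo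
    (hs.differentiableOn (by simp)) (fun z hz => ?_) hy h0⟩
  have e := h.tangential z hz
  rw [h.velocity_eq_zero (Ioo_subset_Icc_self hz), mul_zero, zero_mul] at e
  have h1 : (fun s => η (1 + δ * τ s) * deriv U s) =ᶠ[nhds z]
      fun s => η₀ * (√(1 + δ * τ s) * deriv U s) := by
    filter_upwards [isOpen_Ioo.mem_nhds hz] with s hs
    rw [hη _ (h.temp_pos (Ioo_subset_Icc_self hs)), mul_assoc]
  rw [h1.deriv_eq, ((hs.hasDerivAt_Ioo hz).const_mul η₀).deriv] at e
  exact (mul_eq_zero.mp e.symm).resolve_left hη₀.ne'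

/-- The total energy flux, conductive and viscous, is constant. -/
theorem exists_energy_flux (h : IsHDSolution η κ σ₁ σ₂ C Uminus Uplus δ U u τ r P) {η₀ κ₀ : ℝ}
    (hη₀ : 0 < η₀) (hη : ∀ T, 0 < T → η T = η₀ * √T) (hκ : ∀ T, 0 < T → κ T = κ₀ * √T) :
    ∃ k : ℝ, ∀ y ∈ Ioo (-Real.pi) Real.pi,
      √(1 + δ * τ y) * (κ₀ * deriv τ y + δ * η₀ * (U y * deriv U y)) = k := by
  obtain ⟨k, hk⟩ := h.exists_shear_flux hη₀ hη
  have h0 : (0 : ℝ) ∈ Ioo (-Real.pi) Real.pi := by simp [Real.pi_pos]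
  have hs := h.contDiffOn_sqrt_temp.mul (contDiffOn_deriv_Ioo h.smooth_τ)
  have hd : ∀ z ∈ Ioo (-Real.pi) Real.pi, HasDerivAt
      (fun y => κ₀ * (√(1 + δ * τ y) * deriv τ y) + δ * η₀ * k * U y) 0 z := by
    intro z hz
    have e := h.energy z hz
    rw [h.velocity_eq_zero (Ioo_subset_Icc_self hz), mul_zero, zero_mul] at e
    have h1 : (fun s => κ (1 + δ * τ s) * deriv τ s) =ᶠ[nhds z]
        fun s => κ₀ * (√(1 + δ * τ s) * deriv τ s) := by
      filter_upwards [isOpen_Ioo.mem_nhds hz] with s hs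
      rw [hκ _ (h.temp_pos (Ioo_subset_Icc_self hs)), mul_assoc]
    have h2 := (hs.hasDerivAt_Ioo hz).const_mul κ₀
    rw [h1.deriv_eq, h2.deriv, hη _ (h.temp_pos (Ioo_subset_Icc_self hz))] at e
    have h3 := h2.add ((h.smooth_U.hasDerivAt_Ioo hz).const_mul (δ * η₀ * k))
    refine h3.congr_deriv ?_
    rw [← hk z hz, e]
    ring
  refine ⟨_, fun y hy => Eq.trans ?_ (isOpen_Ioo.is_const_of_deriv_eq_zero isPreconnected_Ioo
    (fun z hz => (hd z hz).differentiableAt.differentiableWithinAt)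
    (fun z hz => (hd z hz).deriv) hy h0)⟩
  rw [← hk y hy]
  ring

/-- The temperature is a quadratic function of the tangential velocity: `κ₀ τ + δ η₀ U² / 2` has
constant flux, so subtracting the multiple of `U` that equates its end values gives a constant. -/
theorem temp_eq_quadratic (h : IsHDSolution η κ σ₁ σ₂ C Uminus Uplus δ U u τ r P) {η₀ κ₀ : ℝ}
    (hη₀ : 0 < η₀) (hη : ∀ T, 0 < T → η T = η₀ * √T) (hκ : ∀ T, 0 < T → κ T = κ₀ * √T) {y : ℝ}
    (hy : y ∈ Icc (-Real.pi) Real.pi) :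
    κ₀ * τ y = δ * η₀ / 2 * ((U y - Uminus) * (Uplus - U y)) := by
  obtain ⟨k, hk⟩ := h.exists_shear_flux hη₀ hη
  obtain ⟨l, hl⟩ := h.exists_energy_flux hη₀ hη hκ
  have hcU := h.cont_U
  have hcτ := h.cont_τ
  have e := eq_left_of_flux_const (a := -Real.pi) (b := Real.pi) (by linarith [Real.pi_pos])
    (f := fun y => κ₀ * τ y + δ * η₀ / 2 * U y ^ 2 - δ * η₀ / 2 * (Uplus + Uminus) * U y)
    (f' := fun y => κ₀ * deriv τ y + δ * η₀ * (U y * deriv U y)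
      - δ * η₀ / 2 * (Uplus + Uminus) * deriv U y)
    (s := fun y => √(1 + δ * τ y)) (k := l - δ * η₀ / 2 * (Uplus + Uminus) * k)
    (by fun_prop) (fun z hz => ?_)
    (fun z hz => (Real.sqrt_pos.mpr (h.temp_pos (Ioo_subset_Icc_self hz))).ne')
    (fun z hz => by
      rw [mul_sub, hl z hz, ← hk z hz]
      ring) ?_ hy
  · simp only [h.U_left, h.τ_left] at e
    linear_combination e
  · have hU := h.smooth_U.hasDerivAt_Ioo hz
    have hτ := h.smooth_τ.hasDerivAt_Ioo hz
    refine (((hτ.const_mul κ₀).add ((hU.pow 2).const_mul (δ * η₀ / 2))).sub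
      (hU.const_mul (δ * η₀ / 2 * (Uplus + Uminus)))).congr_deriv ?_
    push_cast
    ring
  · simp only [h.U_left, h.U_right, h.τ_left, h.τ_right]
    ring

/-- The tangential velocity of a solution is the affine image of the profile. -/
theorem tangential_eq (h : IsHDSolution η κ σ₁ σ₂ C Uminus Uplus δ U u τ r P) {η₀ κ₀ : ℝ}
    (hη₀ : 0 < η₀) (hκ₀ : 0 < κ₀) (hη : ∀ T, 0 < T → η T = η₀ * √T)
    (hκ : ∀ T, 0 < T → κ T = κ₀ * √T) {x : ℝ → ℝ}
    (hx : IsProfile (δ ^ 2 * heatingCoeff η₀ κ₀ Uminus Uplus) x) {y : ℝ}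
    (hy : y ∈ Icc (-Real.pi) Real.pi) : U y = Uminus + (Uplus - Uminus) * x y := by
  obtain ⟨k, hk⟩ := h.exists_shear_flux hη₀ hη
  have hpos : ∀ y ∈ Ioo (-Real.pi) Real.pi, 0 < 1 + δ * τ y := fun y hy =>
    h.temp_pos (Ioo_subset_Icc_self hy)
  rcases eq_or_ne Uplus Uminus with hD | hD
  · rw [eq_left_of_flux_const (by linarith [Real.pi_pos]) h.cont_U
      (fun z hz => h.smooth_U.hasDerivAt_Ioo hz)
      (fun z hz => (Real.sqrt_pos.mpr (hpos z hz)).ne') hk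
      (by rw [h.U_left, h.U_right, hD]) hy, h.U_left, hD]
    ring
  · have hD' : Uplus - Uminus ≠ 0 := sub_ne_zero.mpr hD
    have hε : 0 ≤ δ ^ 2 * heatingCoeff η₀ κ₀ Uminus Uplus := by
      rw [heatingCoeff]
      positivity
    have hT : ∀ y ∈ Icc (-Real.pi) Real.pi, 1 + δ * τ y
        = 1 + δ ^ 2 * heatingCoeff η₀ κ₀ Uminus Uplus * ((U y - Uminus) / (Uplus - Uminus)
          * (1 - (U y - Uminus) / (Uplus - Uminus))) := by
      intro y hy
      have e := h.temp_eq_quadratic hη₀ hη hκ hy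
      rw [heatingCoeff]
      field_simp
      linear_combination (2 * δ) * e
    have hz : IsProfile (δ ^ 2 * heatingCoeff η₀ κ₀ Uminus Uplus)
        (fun y => (U y - Uminus) / (Uplus - Uminus)) := by
      refine isProfile_of_flux_const (k := k / (Uplus - Uminus))
        (z' := fun y => deriv U y / (Uplus - Uminus))
        ((h.cont_U.sub continuousOn_const).div_const _)
        (fun z hz => ((h.smooth_U.hasDerivAt_Ioo hz).sub_const _).div_const _)
        (fun z hz => ?_) (fun z hz => ?_) ?_ ?_
      · rw [← hT z (Ioo_subset_Icc_self hz)]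
        exact hpos z hz
      · rw [← hT z (Ioo_subset_Icc_self hz), ← hk z hz, mul_div_assoc]
      · simp [h.U_left]
      · simp only [h.U_right]
        exact div_self hD'
    have e := hx.eqOn hε hz hy
    rw [e, mul_div_cancel₀ _ hD']
    ring

theorem temp_eq (h : IsHDSolution η κ σ₁ σ₂ C Uminus Uplus δ U u τ r P) {η₀ κ₀ : ℝ}
    (hη₀ : 0 < η₀) (hκ₀ : 0 < κ₀) (hη : ∀ T, 0 < T → η T = η₀ * √T)
    (hκ : ∀ T, 0 < T → κ T = κ₀ * √T) {x : ℝ → ℝ}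
    (hx : IsProfile (δ ^ 2 * heatingCoeff η₀ κ₀ Uminus Uplus) x) {y : ℝ}
    (hy : y ∈ Icc (-Real.pi) Real.pi) :
    τ y = profileTau (heatingCoeff η₀ κ₀ Uminus Uplus) δ x y := by
  have e := h.temp_eq_quadratic hη₀ hη hκ hy
  rw [h.tangential_eq hη₀ hκ₀ hη hκ hx hy] at e
  rw [profileTau, heatingCoeff]
  field_simp
  linear_combination 2 * e

theorem deriv_pressure (h : IsHDSolution η κ σ₁ σ₂ C Uminus Uplus δ U u τ r P) {y : ℝ}
    (hy : y ∈ Ioo (-Real.pi) Real.pi) :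
    deriv P y = 1 / C ^ 2 * (1 + δ * r y) * U y ^ 2
      + deriv (normalStress σ₁ σ₂ δ U τ r) y := by
  have hu : ∀ z ∈ Ioo (-Real.pi) Real.pi, deriv u z = 0 := by
    intro z hz
    have h1 : u =ᶠ[nhds z] fun _ => 0 := by
      filter_upwards [isOpen_Ioo.mem_nhds hz] with s hs
      exact h.velocity_eq_zero (Ioo_subset_Icc_self hs)
    rw [h1.deriv_eq, deriv_const]
  have hu2 : deriv (deriv u) y = 0 := by
    have h1 : deriv u =ᶠ[nhds y] fun _ => 0 := by
      filter_upwards [isOpen_Ioo.mem_nhds hy] with s hs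
      exact hu s hs
    rw [h1.deriv_eq, deriv_const]
  have h2 : (fun s => (η (1 + δ * τ s) - η 1) * deriv u s
            + δ ^ 2 / ((1 + δ * r s) * (1 + δ * τ s)) *
              (σ₁ (1 + δ * τ s) * deriv τ s ^ 2 + σ₂ (1 + δ * τ s) * deriv U s ^ 2))
      =ᶠ[nhds y] normalStress σ₁ σ₂ δ U τ r := by
    filter_upwards [isOpen_Ioo.mem_nhds hy] with s hs
    rw [hu s hs, mul_zero, zero_add, normalStress]
  have e := h.radial y hy
  rw [hu y hy, hu2, h2.deriv_eq] at e
  linear_combination e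

end IsHDSolution

theorem normalStress_congr {σ₁ σ₂ : ℝ → ℝ} {δ a b : ℝ} {U τ r V θ s : ℝ → ℝ}
    (hU : EqOn V U (Ioo a b)) (hτ : EqOn θ τ (Ioo a b)) (hr : EqOn s r (Ioo a b)) :
    EqOn (normalStress σ₁ σ₂ δ V θ s) (normalStress σ₁ σ₂ δ U τ r) (Ioo a b) := by
  intro y hy
  have h1 := (hU.eventuallyEq_of_mem (isOpen_Ioo.mem_nhds hy)).deriv_eq
  have h2 := (hτ.eventuallyEq_of_mem (isOpen_Ioo.mem_nhds hy)).deriv_eq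
  rw [normalStress, normalStress, h1, h2, hτ hy, hr hy]

/-- Two solutions coincide, up to an additive constant in the pressure. -/
theorem IsHDSolution.unique {η κ σ₁ σ₂ : ℝ → ℝ} {C Uminus Uplus δ : ℝ}
    {U u τ r P V w θ s Q : ℝ → ℝ} {η₀ κ₀ : ℝ} (hδ : δ ≠ 0)
    (hη₀ : 0 < η₀) (hκ₀ : 0 < κ₀) (hη : ∀ T, 0 < T → η T = η₀ * √T)
    (hκ : ∀ T, 0 < T → κ T = κ₀ * √T)
    (h : IsHDSolution η κ σ₁ σ₂ C Uminus Uplus δ U u τ r P)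
    (h' : IsHDSolution η κ σ₁ σ₂ C Uminus Uplus δ V w θ s Q) :
    EqOn V U (Icc (-Real.pi) Real.pi) ∧ EqOn w u (Icc (-Real.pi) Real.pi) ∧
      EqOn θ τ (Icc (-Real.pi) Real.pi) ∧ EqOn s r (Icc (-Real.pi) Real.pi) ∧
      ∃ c : ℝ, ∀ y ∈ Ioo (-Real.pi) Real.pi, Q y = P y + c := by
  obtain ⟨x, hx⟩ := exists_isProfile (ε := δ ^ 2 * heatingCoeff η₀ κ₀ Uminus Uplus) (by
    rw [heatingCoeff]
    positivity)
  have eU : EqOn V U (Icc (-Real.pi) Real.pi) := fun y hy => by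
    rw [h.tangential_eq hη₀ hκ₀ hη hκ hx hy, h'.tangential_eq hη₀ hκ₀ hη hκ hx hy]
  have eu : EqOn w u (Icc (-Real.pi) Real.pi) := fun y hy => by
    rw [h.velocity_eq_zero hy, h'.velocity_eq_zero hy]
  have eτ : EqOn θ τ (Icc (-Real.pi) Real.pi) := fun y hy => by
    rw [h.temp_eq hη₀ hκ₀ hη hκ hx hy, h'.temp_eq hη₀ hκ₀ hη hκ hx hy]
  have er : EqOn s r (Icc (-Real.pi) Real.pi) := fun y hy => by
    rw [h.density_eq hδ hy, h'.density_eq hδ hy, densityOf, densityOf, eτ hy]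
  refine ⟨eU, eu, eτ, er, Q 0 - P 0, fun y hy => ?_⟩
  have hW := normalStress_congr (σ₁ := σ₁) (σ₂ := σ₂) (δ := δ) (eU.mono Ioo_subset_Icc_self)
    (eτ.mono Ioo_subset_Icc_self) (er.mono Ioo_subset_Icc_self)
  have hd : ∀ z ∈ Ioo (-Real.pi) Real.pi, HasDerivAt (fun y => Q y - P y) 0 z := by
    intro z hz
    refine ((h'.smooth_P.hasDerivAt_Ioo hz).sub (h.smooth_P.hasDerivAt_Ioo hz)).congr_deriv ?_
    have hz' := Ioo_subset_Icc_self hz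
    rw [h.deriv_pressure hz, h'.deriv_pressure hz, eU hz', er hz',
      (hW.eventuallyEq_of_mem (isOpen_Ioo.mem_nhds hz)).deriv_eq, sub_self]
  have h0 : (0 : ℝ) ∈ Ioo (-Real.pi) Real.pi := by simp [Real.pi_pos]
  have e := isOpen_Ioo.is_const_of_deriv_eq_zero isPreconnected_Ioo
    (fun z hz => (hd z hz).differentiableAt.differentiableWithinAt)
    (fun z hz => (hd z hz).deriv) hy h0
  linear_combination e

/-! ### Distance to the laminar flow -/

theorem abs_densityOf_le {δ : ℝ} (hδ : 0 < δ) {τ : ℝ → ℝ} {y : ℝ} (hτ : 0 ≤ τ y) :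
    |densityOf δ τ y| ≤ τ y := by
  have h1 : 0 ≤ δ * τ y := by positivity
  have e : densityOf δ τ y = -(τ y / (1 + δ * τ y)) := by
    rw [densityOf]
    field_simp
    ring
  rw [e, abs_neg, abs_of_nonneg (by positivity)]
  exact div_le_self hτ (by linarith)

theorem profileTau_bounds {q δ ε : ℝ} (hq : 0 ≤ q) (hδ : 0 ≤ δ) {x : ℝ → ℝ} (hx : IsProfile ε x)
    {y : ℝ} (hy : y ∈ Icc (-Real.pi) Real.pi) :
    0 ≤ profileTau q δ x y ∧ profileTau q δ x y ≤ q * δ := by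
  obtain ⟨h0, h1⟩ := hx.mem y hy
  have h2 : 0 ≤ x y * (1 - x y) := mul_nonneg h0 (by linarith)
  have h3 : x y * (1 - x y) ≤ 1 := by nlinarith
  rw [profileTau]
  refine ⟨by positivity, ?_⟩
  calc _ ≤ δ * q * 1 := by gcongr
    _ = _ := by ring

theorem theorem2p1
    -- the kinetic functions defining the viscosity and the conductivity at each temperature
    (𝔄 𝔅 : ℝ → Velocity → ℝ)
    (h𝔄 : ∀ T : ℝ, 0 < T → IsInverseL T (heatSource T) (𝔄 T))
    (h𝔅 : ∀ T : ℝ, 0 < T → IsInverseL T (shearSource T) (𝔅 T))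
    -- the higher-order transport coefficients: any smooth functions of the temperature
    (σ₁ σ₂ : ℝ → ℝ)
    (hσ₁ : ContDiffOn ℝ ∞ σ₁ (Ioi 0)) (hσ₂ : ContDiffOn ℝ ∞ σ₂ (Ioi 0))
    (C Uminus Uplus : ℝ) (hC : C ≠ 0) :
    ∃ δ₀ : ℝ, 0 < δ₀ ∧ ∃ K : ℝ, 0 < K ∧ ∀ δ : ℝ, 0 < δ → δ < δ₀ →
      ∃ U u τ r P : ℝ → ℝ,
        IsHDSolution (viscosity 𝔅) (conductivity 𝔄) σ₁ σ₂ C Uminus Uplus δ U u τ r P ∧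
        -- the radial velocity vanishes
        (∀ y ∈ Icc (-Real.pi) Real.pi, u y = 0) ∧
        -- the distance to the laminar solution is of order `δ`
        (∀ y ∈ Icc (-Real.pi) Real.pi,
          |U y - couette Uminus Uplus y| ≤ K * δ ∧ |τ y| ≤ K * δ ∧ |r y| ≤ K * δ) ∧
        (∀ y ∈ Ioo (-Real.pi) Real.pi,
          |deriv U y - couetteSlope Uminus Uplus| ≤ K * δ ∧ |deriv τ y| ≤ K * δ) ∧
        -- uniqueness; the pressure is determined up to an additive constant
        (∀ V w θ s Q : ℝ → ℝ,
          IsHDSolution (viscosity 𝔅) (conductivity 𝔄) σ₁ σ₂ C Uminus Uplus δ V w θ s Q →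
          EqOn V U (Icc (-Real.pi) Real.pi) ∧ EqOn w u (Icc (-Real.pi) Real.pi) ∧
          EqOn θ τ (Icc (-Real.pi) Real.pi) ∧ EqOn s r (Icc (-Real.pi) Real.pi) ∧
          ∃ c : ℝ, ∀ y ∈ Ioo (-Real.pi) Real.pi, Q y = P y + c) := by
  have hη₀ := viscosity_one_pos h𝔅
  have hκ₀ := conductivity_one_pos h𝔄
  have hη := fun T (hT : 0 < T) => viscosity_eq_sqrt h𝔅 hT
  have hκ := fun T (hT : 0 < T) => conductivity_eq_sqrt h𝔄 hT
  generalize hq : heatingCoeff (viscosity 𝔅 1) (conductivity 𝔄 1) Uminus Uplus = q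
  have hq0 : 0 ≤ q := by
    rw [← hq, heatingCoeff]
    positivity
  -- existence and uniqueness hold for every `δ > 0`; `δ < 1` only serves the quantitative bounds
  refine ⟨1, one_pos, |Uplus - Uminus| * q + q * (1 + q) + q + 1, by positivity,
    fun δ hδ hδ1 => ?_⟩
  have hε : 0 ≤ δ ^ 2 * q := by positivity
  have hεδ : δ ^ 2 * q ≤ q * δ := by nlinarith [mul_nonneg hq0 hδ.le]
  obtain ⟨x, hx⟩ := exists_isProfile hε
  obtain ⟨P, hP⟩ := exists_isHDSolution (κ := conductivity 𝔄) hη₀ hκ₀ hη hκ hσ₁ hσ₂ C Uminus Uplus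
    hδ (by rwa [hq])
  rw [hq] at hP
  have hK1 : |Uplus - Uminus| * (δ ^ 2 * q)
      ≤ (|Uplus - Uminus| * q + q * (1 + q) + q + 1) * δ := by
    have h1 := mul_le_mul_of_nonneg_left hεδ (abs_nonneg (Uplus - Uminus))
    have h2 : 0 ≤ (q * (1 + q) + q + 1) * δ := by positivity
    linarith
  have hK2 : q * δ ≤ (|Uplus - Uminus| * q + q * (1 + q) + q + 1) * δ := by
    have h2 : 0 ≤ (|Uplus - Uminus| * q + q * (1 + q) + 1) * δ := by positivity
    linarith
  refine ⟨_, _, _, _, P, hP, fun _ _ => rfl, fun y hy => ⟨?_, ?_, ?_⟩, fun y hy => ⟨?_, ?_⟩,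
    fun V w θ s Q hQ => hP.unique hδ.ne' hη₀ hκ₀ hη hκ hQ⟩
  · have e : Uminus + (Uplus - Uminus) * x y - couette Uminus Uplus y
        = (Uplus - Uminus) * (x y - (y + Real.pi) / (2 * Real.pi)) := by
      rw [couette, couetteSlope]
      ring
    rw [e, abs_mul]
    exact (mul_le_mul_of_nonneg_left (hx.abs_sub_le hε hy) (abs_nonneg _)).trans hK1
  · obtain ⟨h1, h2⟩ := profileTau_bounds hq0 hδ.le hx hy
    rw [abs_of_nonneg h1]
    exact h2.trans hK2
  · obtain ⟨h1, h2⟩ := profileTau_bounds hq0 hδ.le hx hy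
    exact (abs_densityOf_le hδ h1).trans (h2.trans hK2)
  · have e : deriv (fun y => Uminus + (Uplus - Uminus) * x y) y - couetteSlope Uminus Uplus
        = (Uplus - Uminus) * (profileInt (δ ^ 2 * q) 1 / (2 * Real.pi)
          / √(1 + δ ^ 2 * q * (x y * (1 - x y))) - 1 / (2 * Real.pi)) := by
      rw [(((hx.hasDerivAt hε hy).const_mul _).const_add _).deriv, couetteSlope]
      ring
    rw [e, abs_mul]
    exact (mul_le_mul_of_nonneg_left (hx.slope_bounds hε (Ioo_subset_Icc_self hy))
      (abs_nonneg _)).trans hK1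
  · have hxd := hx.hasDerivAt hε hy
    have hsl := hx.slope_bounds hε (Ioo_subset_Icc_self hy)
    obtain ⟨hx0, hx1⟩ := hx.mem y (Ioo_subset_Icc_self hy)
    generalize profileInt (δ ^ 2 * q) 1 / (2 * Real.pi)
      / √(1 + δ ^ 2 * q * (x y * (1 - x y))) = d at hxd hsl
    have hd : |d| ≤ 1 + q := by
      have hπ := Real.pi_gt_three
      have h1 : 1 / (2 * Real.pi) ≤ 1 := by
        rw [div_le_one (by positivity)]
        linarith
      have h2 : |1 / (2 * Real.pi)| = 1 / (2 * Real.pi) := abs_of_nonneg (by positivity)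
      have h3 := abs_sub_abs_le_abs_sub d (1 / (2 * Real.pi))
      have h4 : q * δ ≤ q := mul_le_of_le_one_right hq0 hδ1.le
      linarith
    have e : deriv (profileTau q δ x) y = q * δ * ((1 - 2 * x y) * d) := by
      refine ((hxd.mul (hxd.const_sub 1)).const_mul (δ * q)).deriv.trans ?_
      ring
    have hc : |1 - 2 * x y| ≤ 1 := by
      rw [abs_le]
      constructor <;> linarith
    rw [e, abs_mul (q * δ), abs_mul (1 - 2 * x y), abs_of_nonneg (by positivity : 0 ≤ q * δ)]
    have h5 : |1 - 2 * x y| * |d| ≤ 1 * (1 + q) := by gcongr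
    have h6 : 0 ≤ (|Uplus - Uminus| * q + q + 1) * δ := by positivity
    have h7 := mul_le_mul_of_nonneg_left h5 (by positivity : 0 ≤ q * δ)
    linarith
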